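/- Corollary (Rademacher random multiplicative function). Let $(f(p))_{p}$, $p$ prime, be independent random variables on a probability space, each taking the values $+1$ and $-1$ with probability $1/2$, and let $f:\mathbb{N}\to\{-1,0,1\}$ be the associated Rademacher random multiplicative function, that is, $f(1)=1$, $f(mn)=f(m)f(n)$ for coprime $m,n$, and $f(n)=0$ if $n$ is not squarefree. For a real function $g$ on an interval $I$, the number of sign changes of $g$ on $I$ is the supremum, over all finite sequences $a_1<\dots<a_k$ in $I$, of the number of sign changes in the sequence $g(a_1),\dots,g(a_k)$ with zero terms deleted. Let $\log_k$ denote the $k$-th iterate of the natural logarithm. Then there is an absolute constant $c>0$ such that, almost surely, there is a (random) $x_0$ such that for all real $x\ge x_0$ the function $y\mapsto\sum_{n\le y}f(n)$ has at least $$c\,\frac{\log_2 x}{\log_4 x}$$ sign changes on the interval $[1,x]$. -/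

import Mathlib

open MeasureTheory ProbabilityTheory Filter
open scoped ENNReal

/-- `f` (with `f n ω` the value at `n`) is a Rademacher random multiplicative function on the
probability space `(Ω, P)`: the values at the primes are independent and uniform on `{-1, 1}`,
and `f` is multiplicative and supported on the squarefree integers. -/
structure IsRademacherRMF {Ω : Type*} [MeasurableSpace Ω] (P : Measure Ω)
    (f : ℕ → Ω → ℝ) : Prop where
  measurable_prime : ∀ p : ℕ, p.Prime → Measurable (f p)
  indep : iIndepFun (fun p : Nat.Primes => f (p : ℕ)) P
  prob_one : ∀ p : ℕ, p.Prime → P {ω | f p ω = 1} = 1 / 2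
  prob_neg_one : ∀ p : ℕ, p.Prime → P {ω | f p ω = -1} = 1 / 2
  map_one : ∀ ω, f 1 ω = 1
  map_mul : ∀ m n : ℕ, m.Coprime n → ∀ ω, f (m * n) ω = f m ω * f n ω
  map_not_squarefree : ∀ n : ℕ, ¬ Squarefree n → ∀ ω, f n ω = 0

/-- The partial sum `∑_{n ≤ y} a n` over positive integers `n`, for real `y`. -/
noncomputable def partialSum (a : ℕ → ℝ) (y : ℝ) : ℝ :=
  ∑ n ∈ Finset.Icc 1 ⌊y⌋₊, a n

/-- The number of sign changes in a finite real sequence, zero terms being deleted. -/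
noncomputable def seqSignChanges (l : List ℝ) : ℕ :=
  (((l.map SignType.sign).filter (· ≠ 0)).destutter (· ≠ ·)).length - 1

/-- The number of sign changes of `g` on the set `I`: the supremum of the number of sign changes
of `g a₁, …, g aₖ` over all finite sequences `a₁ < ⋯ < aₖ` in `I`. -/
noncomputable def signChangesOn (g : ℝ → ℝ) (I : Set ℝ) : ℕ∞ :=
  ⨆ (l : List ℝ) (_ : l.Pairwise (· < ·) ∧ ∀ a ∈ l, a ∈ I), (seqSignChanges (l.map g) : ℕ∞)

/-- The `k`-th iterate of the natural logarithm. -/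
noncomputable def iterLog (k : ℕ) (x : ℝ) : ℝ := Real.log^[k] x

/-! Write M for the partial sums. At the scale R = 2^(2^j), reveal the signs of the primes up to
R^8. For n in the window (R^8, R^11], no integer up to n has two distinct prime factors above R^8.
Hence M(n) is a frozen smooth part plus the Rademacher sum of f(p) M(n/p) over R^8 < p ≤ n, whose
coefficients are frozen too; let V(n) be the sum of their squares.

If some n is good (smooth part at most D√V(n), no dominating coefficient), an exponential
second-moment argument gives each sign of M(n) a conditional probability bounded below
(`le_measureReal_sum_gt`, `le_measureReal_sign`). If no n is good, the smooth part dominates in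
logarithmic mean square, while a weak Mertens bound makes the mean of V at least a constant times
the energy ∑ M(m)²/m² over m < R. So with high conditional probability the energy below R^16 is a
large multiple of the energy below R (`measureReal_not_growth_le`).

The expected energy below 2^(2^k) is O(2^k), so such growth occurs at no more than a quarter of the
scales. Products of factors of conditional mean at most one (`ae_eventually_prod_le`) bound the
failures of growth by another quarter, and turn a positive proportion of good scales into linearly
many alternations of sign. About log log x scales lie below x, so the number of sign changes has
order at least log_2 x, more than is required. -/

/-! ### Fair bits and resampling -/

/-- The primes up to `N`. -/
def primesUpTo (N : ℕ) : Set ℕ := {p | p.Prime ∧ p ≤ N}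

theorem primesUpTo_mono {M N : ℕ} (h : M ≤ N) : primesUpTo M ⊆ primesUpTo N :=
  fun _ hp => ⟨hp.1, hp.2.trans h⟩

theorem finite_primesUpTo (N : ℕ) : Finite (primesUpTo N) :=
  ((Set.finite_Iic N).subset fun _ hp => hp.2).to_subtype

/-- A family of independent fair bits indexed by the primes. -/
structure IsFairBits {Ω : Type*} [MeasurableSpace Ω] (P : Measure Ω) (b : Ω → ℕ → Bool) :
    Prop where
  measurable : ∀ p : ℕ, p.Prime → Measurable fun ω => b ω p
  indep : iIndepFun (fun (p : Nat.Primes) ω => b ω p) P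
  integral_eq : ∀ p : ℕ, p.Prime → ∀ g : Bool → ℝ,
    ∫ ω, g (b ω p) ∂P = (g true + g false) / 2

/-- Keep the bits of `u` up to `N`, and take those of `v` beyond. -/
def mix (N : ℕ) (u v : ℕ → Bool) : ℕ → Bool := fun p => if p ≤ N then u p else v p

theorem mix_of_le {N p : ℕ} (h : p ≤ N) (u v : ℕ → Bool) : mix N u v p = u p := if_pos h

theorem mix_of_lt {N p : ℕ} (h : N < p) (u v : ℕ → Bool) : mix N u v p = v p :=
  if_neg (not_le.mpr h)

theorem DependsOn.mix_eq {α : Type*} {φ : (ℕ → Bool) → α} {N : ℕ}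
    (h : DependsOn φ (primesUpTo N)) (u v : ℕ → Bool) : φ (mix N u v) = φ u :=
  h fun _ hp => mix_of_le hp.2 u v

theorem DependsOn.mix_right {α : Type*} {φ : (ℕ → Bool) → α} {N : ℕ}
    (h : DependsOn φ (primesUpTo N)) (M : ℕ) (u : ℕ → Bool) :
    DependsOn (fun v => φ (mix M u v)) (primesUpTo N) := by
  intro v w hvw
  refine h fun p hp => ?_
  simp only [mix, hvw p hp]

namespace IsFairBits

variable {Ω : Type*} [MeasurableSpace Ω] {P : Measure Ω} {b : Ω → ℕ → Bool}

/-- A function of finitely many bits factors through a finite discrete space, so measurability is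
automatic. -/
theorem measurable_comp {α : Type*} [MeasurableSpace α] [Nonempty α] (hb : IsFairBits P b)
    {φ : (ℕ → Bool) → α} {N : ℕ} (h : DependsOn φ (primesUpTo N)) :
    Measurable fun ω => φ (b ω) := by
  obtain ⟨g, rfl⟩ := dependsOn_iff_exists_comp.mp h
  have := finite_primesUpTo N
  exact (Measurable.of_discrete (f := g)).comp
    (measurable_pi_lambda _ fun p => hb.measurable p p.2.1)

theorem integrable_comp [IsFiniteMeasure P] (hb : IsFairBits P b)
    {φ : (ℕ → Bool) → ℝ} {N : ℕ} (h : DependsOn φ (primesUpTo N)) :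
    Integrable (fun ω => φ (b ω)) P := by
  obtain ⟨g, rfl⟩ := dependsOn_iff_exists_comp.mp h
  have := finite_primesUpTo N
  exact (Integrable.of_finite (f := g)).comp_measurable
    (measurable_pi_lambda _ fun p => hb.measurable p p.2.1)

theorem measurableSet_setOf (hb : IsFairBits P b) {A : (ℕ → Bool) → Prop} {N : ℕ}
    (h : DependsOn A (primesUpTo N)) : MeasurableSet {ω | A (b ω)} :=
  measurableSet_setOfPred.mpr (hb.measurable_comp h)

theorem integral_prod [IsProbabilityMeasure P] (hb : IsFairBits P b) (s : Finset ℕ)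
    (hs : ∀ p ∈ s, p.Prime) (g : ℕ → Bool → ℝ) :
    ∫ ω, ∏ p ∈ s, g p (b ω p) ∂P = ∏ p ∈ s, (g p true + g p false) / 2 := by
  have hind : iIndepFun (fun (p : s) ω => b ω p) P :=
    hb.indep.precomp (g := fun p : s => (⟨p, hs p p.2⟩ : Nat.Primes))
      fun p q hpq => Subtype.ext (congrArg (fun x : Nat.Primes => (x : ℕ)) hpq)
  have := hind.integral_fun_prod_comp (f := fun p : s => g p)
    (fun p => (hb.measurable p (hs p p.2)).aemeasurable)
    (fun p => Measurable.of_discrete.aestronglyMeasurable)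
  simp only [fun p : s => hb.integral_eq p (hs p p.2)] at this
  rw [← Finset.prod_coe_sort s fun p => (g p true + g p false) / 2, ← this]
  congr with ω
  exact (Finset.prod_coe_sort s fun p => g p (b ω p)).symm

/-- Fubini for the independent blocks of primes up to N and in (N, M]. It replaces conditioning on
the primes up to N: the first argument of `mix` is frozen, the second is fresh. -/
theorem lintegral_resample [IsProbabilityMeasure P] (hb : IsFairBits P b)
    {φ : (ℕ → Bool) → ℝ≥0∞} {M : ℕ} (h : DependsOn φ (primesUpTo M)) (N : ℕ) :
    ∫⁻ ω, φ (b ω) ∂P = ∫⁻ ω, ∫⁻ ω', φ (mix N (b ω) (b ω')) ∂P ∂P := by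
  classical
  let S : Finset Nat.Primes := (Finset.range (N + 1)).subtype Nat.Prime
  let T : Finset Nat.Primes := (Finset.Ioc N M).subtype Nat.Prime
  have hmS : ∀ p : Nat.Primes, p ∈ S ↔ (p : ℕ) < N + 1 := fun p =>
    (Finset.mem_subtype (p := Nat.Prime)).trans Finset.mem_range
  have hmT : ∀ p : Nat.Primes, p ∈ T ↔ N < (p : ℕ) ∧ (p : ℕ) ≤ M := fun p =>
    (Finset.mem_subtype (p := Nat.Prime)).trans Finset.mem_Ioc
  have hST : Disjoint S T := by
    refine Finset.disjoint_left.mpr fun p hp hq => ?_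
    rw [hmS] at hp
    rw [hmT] at hq
    omega
  let U : Ω → S → Bool := fun ω p => b ω p
  let V : Ω → T → Bool := fun ω p => b ω p
  have hU : Measurable U := measurable_pi_lambda _ fun p => hb.measurable _ p.1.2
  have hV : Measurable V := measurable_pi_lambda _ fun p => hb.measurable _ p.1.2
  have hUV : IndepFun U V P :=
    hb.indep.indepFun_finset S T hST fun p => hb.measurable p p.2
  -- The default `false` is harmless, since every prime up to M lies in S or T and φ sees no other
  -- coordinate.
  let glue : (S → Bool) → (T → Bool) → ℕ → Bool := fun u v p =>
    if hS : ∃ hp : p.Prime, (⟨p, hp⟩ : Nat.Primes) ∈ S then u ⟨⟨p, hS.1⟩, hS.2⟩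
    else if hT : ∃ hp : p.Prime, (⟨p, hp⟩ : Nat.Primes) ∈ T then v ⟨⟨p, hT.1⟩, hT.2⟩
    else false
  have hglue : ∀ ω ω', φ (mix N (b ω) (b ω')) = φ (glue (U ω) (V ω')) := by
    intro ω ω'
    refine h fun p hp => ?_
    by_cases hpN : p ≤ N
    · have : ∃ hp : p.Prime, (⟨p, hp⟩ : Nat.Primes) ∈ S :=
        ⟨hp.1, (hmS _).mpr (Nat.lt_succ_of_le hpN)⟩
      simp only [glue, dif_pos this, U, mix_of_le hpN]
    · have h1 : ¬ ∃ hp : p.Prime, (⟨p, hp⟩ : Nat.Primes) ∈ S := by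
        rintro ⟨_, hx⟩
        exact hpN (Nat.lt_succ_iff.mp ((hmS _).mp hx))
      have h2 : ∃ hp : p.Prime, (⟨p, hp⟩ : Nat.Primes) ∈ T :=
        ⟨hp.1, (hmT _).mpr ⟨not_le.mp hpN, hp.2⟩⟩
      simp only [glue, dif_neg h1, dif_pos h2, V, mix_of_lt (not_le.mp hpN)]
  have hself : ∀ ω, φ (b ω) = φ (glue (U ω) (V ω)) := by
    intro ω
    rw [← hglue]
    congr 1
    ext p
    simp [mix]
  have hψ : Measurable fun z : (S → Bool) × (T → Bool) => φ (glue z.1 z.2) :=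
    Measurable.of_discrete
  simp only [hglue]
  calc ∫⁻ ω, φ (b ω) ∂P = ∫⁻ ω, φ (glue (U ω) (V ω)) ∂P := by simp only [hself]
    _ = ∫⁻ z, φ (glue z.1 z.2) ∂(P.map fun ω => (U ω, V ω)) :=
        (lintegral_map hψ (hU.prodMk hV)).symm
    _ = ∫⁻ u, ∫⁻ v, φ (glue u v) ∂(P.map V) ∂(P.map U) := by
        rw [hUV.map_prod_eq_prod_map_map hU.aemeasurable hV.aemeasurable,
          lintegral_prod _ hψ.aemeasurable]
    _ = ∫⁻ ω, ∫⁻ v, φ (glue (U ω) v) ∂(P.map V) ∂P :=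
        lintegral_map Measurable.of_discrete hU
    _ = _ := by
        refine lintegral_congr fun ω => ?_
        exact lintegral_map (f := fun v => φ (glue (U ω) v)) Measurable.of_discrete hV

end IsFairBits

theorem IsRademacherRMF.isFairBits {Ω : Type*} [MeasurableSpace Ω] {P : Measure Ω}
    [IsProbabilityMeasure P] {f : ℕ → Ω → ℝ} (hf : IsRademacherRMF P f) :
    IsFairBits P fun ω p => decide (f p ω = 1) := by
  have hmeas : ∀ p : ℕ, p.Prime → Measurable fun ω => decide (f p ω = 1) := fun p hp =>
    measurable_to_bool (by
      have : (fun ω => decide (f p ω = 1)) ⁻¹' {true} = f p ⁻¹' {1} := by ext; simp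
      rw [this]
      exact hf.measurable_prime p hp (measurableSet_singleton 1))
  refine ⟨hmeas, ?_, ?_⟩
  · refine hf.indep.comp (fun _ x => decide (x = 1)) fun p => measurable_to_bool ?_
    have : (fun x : ℝ => decide (x = 1)) ⁻¹' {true} = {1} := by ext; simp
    rw [this]
    exact measurableSet_singleton 1
  · intro p hp g
    have hset : MeasurableSet {ω | f p ω = 1} :=
      hf.measurable_prime p hp (measurableSet_singleton 1)
    have h1 : P.real {ω | f p ω = 1} = 1 / 2 := by
      rw [measureReal_def, hf.prob_one p hp]; simp
    have heq : (fun ω => g (decide (f p ω = 1))) =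
        fun ω => {ω | f p ω = 1}.indicator (fun _ => g true - g false) ω + g false := by
      ext ω
      by_cases h : f p ω = 1 <;> simp [h, Set.indicator]
    rw [heq, integral_add ((integrable_const _).indicator hset) (integrable_const _),
      integral_indicator_const _ hset, h1]
    simp
    ring

/-! ### The multiplicative function and its splitting at large primes -/

/-- The sign `±1` attached to a bit. -/
noncomputable def bitSign (x : Bool) : ℝ := if x then 1 else -1

@[simp] theorem bitSign_true : bitSign true = 1 := rfl

@[simp] theorem bitSign_false : bitSign false = -1 := by simp [bitSign]

theorem bitSign_mul_self (x : Bool) : bitSign x * bitSign x = 1 := by cases x <;> simp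

/-- The multiplicative function supported on squarefree integers with prime values given by `e`. -/
noncomputable def rmf (e : ℕ → Bool) (n : ℕ) : ℝ :=
  if Squarefree n then ∏ p ∈ n.primeFactors, bitSign (e p) else 0

/-- The partial sums of `rmf`. -/
noncomputable def rmfSum (e : ℕ → Bool) (n : ℕ) : ℝ := ∑ m ∈ Finset.Icc 1 n, rmf e m

/-- The partial sums of `rmf` over the integers without prime factor above `N`. -/
noncomputable def smoothSum (N : ℕ) (e : ℕ → Bool) (n : ℕ) : ℝ :=
  ∑ m ∈ Finset.Icc 1 n with ∀ p ∈ m.primeFactors, p ≤ N, rmf e m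

/-- The primes in `(N, n]`. -/
def primesIoc (N n : ℕ) : Finset ℕ := {p ∈ Finset.Ioc N n | p.Prime}

theorem mem_primesIoc {N n p : ℕ} : p ∈ primesIoc N n ↔ (N < p ∧ p ≤ n) ∧ p.Prime := by
  simp [primesIoc]

/-- The conditional variance of `rmfSum` given the primes up to `N`. -/
noncomputable def varSum (N : ℕ) (e : ℕ → Bool) (n : ℕ) : ℝ :=
  ∑ p ∈ primesIoc N n, rmfSum e (n / p) ^ 2

theorem abs_rmf_le_one (e : ℕ → Bool) (n : ℕ) : |rmf e n| ≤ 1 := by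
  unfold rmf
  split_ifs
  · rw [Finset.abs_prod]
    exact Finset.prod_le_one (fun _ _ => abs_nonneg _) fun p _ => by cases e p <;> simp
  · simp

theorem abs_rmfSum_le (e : ℕ → Bool) (n : ℕ) : |rmfSum e n| ≤ n := by
  calc |rmfSum e n| ≤ ∑ m ∈ Finset.Icc 1 n, |rmf e m| := Finset.abs_sum_le_sum_abs _ _
    _ ≤ ∑ m ∈ Finset.Icc 1 n, (1 : ℝ) := Finset.sum_le_sum fun m _ => abs_rmf_le_one e m
    _ = n := by simp

@[simp] theorem rmf_one (e : ℕ → Bool) : rmf e 1 = 1 := by simp [rmf]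

@[simp] theorem rmfSum_one (e : ℕ → Bool) : rmfSum e 1 = 1 := by simp [rmfSum]

theorem rmf_congr {e e' : ℕ → Bool} {n : ℕ} (h : ∀ p ∈ n.primeFactors, e p = e' p) :
    rmf e n = rmf e' n := by
  unfold rmf
  rw [Finset.prod_congr rfl fun p hp => by rw [h p hp]]

theorem rmf_prime_mul (e : ℕ → Bool) {p m : ℕ} (hp : p.Prime) (hm : ¬ p ∣ m) :
    rmf e (p * m) = bitSign (e p) * rmf e m := by
  have hc : p.Coprime m := (Nat.Prime.coprime_iff_not_dvd hp).mpr hm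
  unfold rmf
  simp only [Nat.squarefree_mul hc, hc.primeFactors_mul, hp.primeFactors]
  by_cases h : Squarefree m
  · rw [if_pos ⟨hp.squarefree, h⟩, if_pos h, Finset.prod_union, Finset.prod_singleton]
    simpa using fun _ h => absurd h hm
  · rw [if_neg fun h' => h h'.2, if_neg h, mul_zero]

theorem dependsOn_rmfSum {N n : ℕ} (h : n ≤ N) :
    DependsOn (fun e => rmfSum e n) (primesUpTo N) := by
  intro e e' hee
  refine Finset.sum_congr rfl fun m hm => rmf_congr fun p hp => hee p ?_
  have := Finset.mem_Icc.mp hm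
  exact ⟨Nat.prime_of_mem_primeFactors hp, (Nat.le_of_mem_primeFactors hp).trans (by omega)⟩

theorem dependsOn_smoothSum (N n : ℕ) :
    DependsOn (fun e => smoothSum N e n) (primesUpTo N) := by
  intro e e' hee
  refine Finset.sum_congr rfl fun m hm => rmf_congr fun p hp => hee p ?_
  exact ⟨Nat.prime_of_mem_primeFactors hp, (Finset.mem_filter.mp hm).2 p hp⟩

theorem div_le_of_mem_primesIoc {N n p : ℕ} (hn : n ≤ N ^ 2) (hp : p ∈ primesIoc N n) :
    n / p ≤ N := by
  have := (mem_primesIoc.mp hp).1.1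
  refine Nat.div_le_of_le_mul (hn.trans ?_)
  rw [sq]
  gcongr

theorem dependsOn_varSum {N n : ℕ} (hn : n ≤ N ^ 2) :
    DependsOn (fun e => varSum N e n) (primesUpTo N) := by
  intro e e' hee
  refine Finset.sum_congr rfl fun p hp => ?_
  exact congrArg (· ^ 2) (dependsOn_rmfSum (div_le_of_mem_primesIoc hn hp) hee)

/-- In m = pj the cofactor satisfies j ≤ n/p ≤ N < p, so p does not divide j and multiplicativity
applies. -/
theorem sum_rmf_multiples (e : ℕ → Bool) {N n p : ℕ} (hn : n ≤ N ^ 2)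
    (hp : p ∈ primesIoc N n) :
    ∑ m ∈ Finset.Icc 1 n with p ∣ m, rmf e m = bitSign (e p) * rmfSum e (n / p) := by
  have hpr := (mem_primesIoc.mp hp).2
  have hNp := (mem_primesIoc.mp hp).1.1
  rw [rmfSum, Finset.mul_sum]
  symm
  refine Finset.sum_nbij (fun j => p * j) ?_ ?_ ?_ ?_
  · intro j hj
    have hj := Finset.mem_Icc.mp hj
    simp only [Finset.mem_filter, Finset.mem_Icc, dvd_mul_right, and_true]
    exact ⟨Nat.mul_pos hpr.pos hj.1, (Nat.mul_le_mul_left p hj.2).trans (Nat.mul_div_le n p)⟩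
  · intro i _ j _ hij
    exact Nat.eq_of_mul_eq_mul_left hpr.pos hij
  · intro m hm
    simp only [Finset.coe_filter, Finset.mem_Icc, Set.mem_ofPred_eq] at hm
    obtain ⟨⟨h1, h2⟩, j, rfl⟩ := hm
    refine ⟨j, ?_, rfl⟩
    simp only [Finset.coe_Icc, Set.mem_Icc]
    exact ⟨Nat.pos_of_mul_pos_left h1, (Nat.le_div_iff_mul_le hpr.pos).mpr (by linarith)⟩
  · intro j hj
    have hj := Finset.mem_Icc.mp hj
    refine (rmf_prime_mul e hpr fun hdvd => ?_).symm
    have := Nat.le_of_dvd hj.1 hdvd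
    have := div_le_of_mem_primesIoc hn hp
    omega

/-- Two distinct primes above N have product above N² ≥ n, so each m ≤ n that is not smooth is
counted for exactly one large prime. -/
theorem rmfSum_eq_smoothSum_add (e : ℕ → Bool) {N n : ℕ} (hn : n ≤ N ^ 2) :
    rmfSum e n = smoothSum N e n + ∑ p ∈ primesIoc N n, bitSign (e p) * rmfSum e (n / p) := by
  classical
  rw [rmfSum, smoothSum, ← Finset.sum_filter_add_sum_filter_not (Finset.Icc 1 n)
    fun m => ∀ p ∈ m.primeFactors, p ≤ N]
  congr 1
  rw [Finset.sum_congr rfl fun p hp => (sum_rmf_multiples e hn hp).symm]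
  simp only [Finset.sum_filter (s := Finset.Icc 1 n)]
  rw [Finset.sum_comm]
  refine Finset.sum_congr rfl fun m hm => ?_
  have hm := Finset.mem_Icc.mp hm
  split_ifs with h
  · refine (Finset.sum_eq_zero fun p hp => if_neg fun hpm => ?_).symm
    have hpp := mem_primesIoc.mp hp
    have := h p (Nat.mem_primeFactors.mpr ⟨hpp.2, hpm, by omega⟩)
    omega
  · push Not at h
    obtain ⟨q, hq, hqN⟩ := h
    have hqp := Nat.prime_of_mem_primeFactors hq
    have hqm := Nat.dvd_of_mem_primeFactors hq
    rw [Finset.sum_eq_single q, if_pos hqm]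
    · intro p hp hpq
      have hpp := mem_primesIoc.mp hp
      refine if_neg fun hpm => ?_
      have hdvd : p * q ∣ m := Nat.Coprime.mul_dvd_of_dvd_of_dvd
        ((Nat.coprime_primes hpp.2 hqp).mpr hpq) hpm hqm
      have := Nat.le_of_dvd hm.1 hdvd
      nlinarith [hpp.1.1]
    · intro hq'
      exact absurd (mem_primesIoc.mpr ⟨⟨hqN, (Nat.le_of_dvd hm.1 hqm).trans hm.2⟩, hqp⟩) hq'

/-- Once the bits up to N are frozen, the partial sum is affine in the fresh signs: n/p ≤ N freezes
the coefficients as well. -/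
theorem rmfSum_mix {N n : ℕ} (hn : n ≤ N ^ 2) (u v : ℕ → Bool) :
    rmfSum (mix N u v) n =
      smoothSum N u n + ∑ p ∈ primesIoc N n, bitSign (v p) * rmfSum u (n / p) := by
  rw [rmfSum_eq_smoothSum_add _ hn, (dependsOn_smoothSum N n).mix_eq u v]
  congr 1
  refine Finset.sum_congr rfl fun p hp => ?_
  rw [mix_of_lt (mem_primesIoc.mp hp).1.1,
    (dependsOn_rmfSum (div_le_of_mem_primesIoc hn hp)).mix_eq u v]

/-- The bit encoding sends every value other than 1 to -1, so the identity needs the almost sure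
event that all prime values are ±1. -/
theorem IsRademacherRMF.ae_eq_rmf {Ω : Type*} [MeasurableSpace Ω] {P : Measure Ω}
    [IsProbabilityMeasure P] {f : ℕ → Ω → ℝ} (hf : IsRademacherRMF P f) :
    ∀ᵐ ω ∂P, ∀ n, f n ω = rmf (fun p => decide (f p ω = 1)) n := by
  have hpm : ∀ᵐ ω ∂P, ∀ p : Nat.Primes, f p ω = 1 ∨ f p ω = -1 := by
    refine ae_all_iff.mpr fun p => ?_
    have hA : MeasurableSet {ω | f p ω = 1} :=
      hf.measurable_prime p p.2 (measurableSet_singleton 1)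
    have hB : MeasurableSet {ω | f p ω = -1} :=
      hf.measurable_prime p p.2 (measurableSet_singleton (-1))
    have hd : Disjoint {ω | f p ω = 1} {ω | f p ω = -1} := by
      refine Set.disjoint_left.mpr fun ω h1 h2 => ?_
      simp only [Set.mem_ofPred_eq] at h1 h2
      rw [h1] at h2
      norm_num at h2
    have h1 : P ({ω | f p ω = 1} ∪ {ω | f p ω = -1}) = 1 := by
      rw [measure_union hd hB, hf.prob_one p p.2, hf.prob_neg_one p p.2, ENNReal.add_halves]
    exact (prob_compl_eq_zero_iff (hA.union hB)).mpr h1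
  filter_upwards [hpm] with ω hω n
  have hprod : ∀ s : Finset ℕ, (∀ p ∈ s, p.Prime) → f (∏ p ∈ s, p) ω = ∏ p ∈ s, f p ω := by
    intro s
    induction s using Finset.induction_on with
    | empty => intro _; simp [hf.map_one]
    | insert p s hps ih =>
      intro hs
      rw [Finset.prod_insert hps, Finset.prod_insert hps, hf.map_mul, ih fun q hq =>
        hs q (Finset.mem_insert_of_mem hq)]
      refine Nat.Coprime.prod_right fun q hq => ?_
      refine (Nat.coprime_primes (hs p (Finset.mem_insert_self p s))
        (hs q (Finset.mem_insert_of_mem hq))).mpr ?_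
      rintro rfl
      exact hps hq
  unfold rmf
  split_ifs with h
  · conv_lhs => rw [← Nat.prod_primeFactors_of_squarefree h]
    rw [hprod _ fun p hp => Nat.prime_of_mem_primeFactors hp]
    refine Finset.prod_congr rfl fun p hp => ?_
    have h2 := hω ⟨p, Nat.prime_of_mem_primeFactors hp⟩
    change f p ω = 1 ∨ f p ω = -1 at h2
    rcases h2 with h2 | h2
    · simp [h2]
    · norm_num [h2]
  · exact hf.map_not_squarefree n h ω

theorem partialSum_eq_rmfSum {a : ℕ → ℝ} {e : ℕ → Bool} (h : ∀ n, a n = rmf e n) (n : ℕ) :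
    partialSum a n = rmfSum e n := by
  simp [partialSum, rmfSum, h]

/-! ### Chebyshev bounds and reciprocals of primes -/

theorem sum_primesIoc_add (g : ℕ → ℝ) {a b c : ℕ} (hab : a ≤ b) (hbc : b ≤ c) :
    ∑ p ∈ primesIoc a c, g p = ∑ p ∈ primesIoc a b, g p + ∑ p ∈ primesIoc b c, g p := by
  unfold primesIoc
  simp only [Finset.sum_filter]
  exact (Finset.sum_Ioc_consecutive _ hab hbc).symm

/-- The bounds used have leading terms x log 2 from below and x log 4 from above. They cancel over
an interval of ratio 2; ratio 4 leaves 2 log 2 > 1 times the left endpoint. -/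
theorem eventually_theta_diff :
    ∀ᶠ i : ℕ in atTop, (2 : ℝ) ^ i ≤ Chebyshev.theta (2 ^ (i + 2)) - Chebyshev.theta (2 ^ i) := by
  have h1 : ∀ᶠ x : ℝ in atTop, Real.log x ≤ (1 / 100) * x ^ (1 / 4 : ℝ) := by
    have := (isLittleO_log_rpow_atTop (r := 1 / 4) (by norm_num)).bound
      (c := 1 / 100) (by norm_num)
    filter_upwards [this, eventually_ge_atTop 1] with x hx hx1
    rw [Real.norm_of_nonneg (Real.log_nonneg hx1), Real.norm_of_nonneg (by positivity)] at hx
    exact hx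
  have h2 : Tendsto (fun i : ℕ => (2 : ℝ) ^ (i + 2)) atTop atTop :=
    (tendsto_pow_atTop_atTop_of_one_lt one_lt_two).comp (tendsto_add_atTop_nat 2)
  filter_upwards [h2.eventually h1, h2.eventually_ge_atTop 10] with i hi hi10
  set x : ℝ := 2 ^ (i + 2) with hx
  have hx4 : x = 4 * 2 ^ i := by rw [hx, pow_add]; ring
  have hx0 : 0 < x := by positivity
  have hlow : x * Real.log 2 - Real.log (x + 1) - 2 * √x * Real.log x ≤ Chebyshev.theta x := by
    have := Chebyshev.theta_ge (2 ^ (i + 2))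
    push_cast at this
    rwa [← hx] at this
  have hup : Chebyshev.theta (2 ^ i) ≤ Real.log 4 * 2 ^ i :=
    Chebyshev.theta_le_log4_mul_x (by positivity)
  have hlog4 : Real.log 4 = 2 * Real.log 2 := by
    rw [show (4 : ℝ) = 2 ^ 2 by norm_num, Real.log_pow]; norm_num
  have hq : x ^ (1 / 4 : ℝ) ≤ √x := by
    rw [Real.sqrt_eq_rpow]
    exact Real.rpow_le_rpow_of_exponent_le (by linarith) (by norm_num)
  have hs : √x * √x = x := Real.mul_self_sqrt hx0.le
  have hq2 : √x * x ^ (1 / 4 : ℝ) ≤ x := by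
    calc √x * x ^ (1 / 4 : ℝ) ≤ √x * √x := by gcongr
      _ = x := hs
  have hlog1 : Real.log (x + 1) ≤ Real.log x + 1 / 10 := by
    have : x + 1 = x * (1 + 1 / x) := by field_simp
    rw [this, Real.log_mul hx0.ne' (by positivity)]
    have h3 := Real.log_le_sub_one_of_pos (x := 1 + 1 / x) (by positivity)
    have h4 : 1 / x ≤ 1 / 10 := one_div_le_one_div_of_le (by norm_num) hi10
    linarith
  have hsx : √x ≤ x := by
    have : 1 ≤ √x := Real.one_le_sqrt.mpr (by linarith)
    nlinarith
  have h5 : 2 * √x * Real.log x ≤ (2 / 100) * x := by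
    calc 2 * √x * Real.log x ≤ 2 * √x * ((1 / 100) * x ^ (1 / 4 : ℝ)) := by gcongr
      _ = (2 / 100) * (√x * x ^ (1 / 4 : ℝ)) := by ring
      _ ≤ _ := by gcongr
  have hl2 := Real.log_two_gt_d9
  have hl2' := Real.log_two_lt_d9
  rw [hlog4] at hup
  nlinarith

theorem theta_diff_eq (a b : ℕ) (hab : a ≤ b) :
    Chebyshev.theta b - Chebyshev.theta a = ∑ p ∈ primesIoc a b, Real.log p := by
  have h : ∀ n : ℕ, Chebyshev.theta n = ∑ p ∈ primesIoc 0 n, Real.log p := by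
    intro n
    rw [Chebyshev.theta, Nat.floor_natCast]
    rfl
  rw [h, h, sum_primesIoc_add _ (Nat.zero_le a) hab]
  ring

theorem eventually_sum_inv_primesIoc :
    ∀ᶠ i : ℕ in atTop,
      1 / (4 * ((i : ℝ) + 2)) ≤ ∑ p ∈ primesIoc (2 ^ i) (2 ^ (i + 2)), (1 : ℝ) / p := by
  filter_upwards [eventually_theta_diff] with i hi
  have h := theta_diff_eq (2 ^ i) (2 ^ (i + 2)) (Nat.pow_le_pow_right (by norm_num) (by omega))
  push_cast at h
  rw [h] at hi
  have hlog : ∀ p ∈ primesIoc (2 ^ i) (2 ^ (i + 2)),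
      Real.log p ≤ (2 ^ i * (4 * ((i : ℝ) + 2))) * (1 / p) := by
    intro p hp
    have hp' := mem_primesIoc.mp hp
    have hp0 : (0 : ℝ) < p := Nat.cast_pos.mpr hp'.2.pos
    have hple : (p : ℝ) ≤ 2 ^ (i + 2) := by exact_mod_cast hp'.1.2
    have h1 : Real.log p ≤ (i + 2 : ℝ) := by
      calc Real.log p ≤ Real.log (2 ^ (i + 2)) := Real.log_le_log hp0 hple
        _ = (i + 2 : ℝ) * Real.log 2 := by rw [Real.log_pow]; push_cast; ring
        _ ≤ (i + 2 : ℝ) * 1 := by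
            have := Real.log_two_lt_d9
            gcongr
            linarith
        _ = _ := mul_one _
    rw [mul_one_div, le_div_iff₀ hp0]
    calc Real.log p * p ≤ (i + 2 : ℝ) * 2 ^ (i + 2) := by
          gcongr
      _ = _ := by rw [pow_add]; ring
  have := hi.trans (Finset.sum_le_sum hlog)
  rw [← Finset.mul_sum, mul_assoc] at this
  have h2 := le_of_mul_le_mul_left (by simpa using this) (by positivity : (0 : ℝ) < 2 ^ i)
  rw [div_le_iff₀ (by positivity), mul_comm]
  simpa using h2

/-- A weak form of Mertens' theorem on the intervals `(R ^ 9, R ^ 10]`, `R = 2 ^ 2 ^ j`. -/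
theorem eventually_sum_inv_primesIoc_pow :
    ∀ᶠ j : ℕ in atTop,
      (1 : ℝ) / 80 ≤ ∑ p ∈ primesIoc ((2 ^ 2 ^ j) ^ 9) ((2 ^ 2 ^ j) ^ 10), (1 : ℝ) / p := by
  obtain ⟨i₀, hi₀⟩ := eventually_atTop.mp eventually_sum_inv_primesIoc
  filter_upwards [eventually_ge_atTop i₀, eventually_ge_atTop 1] with j hj hj1
  obtain ⟨k, rfl⟩ : ∃ k, j = k + 1 := ⟨j - 1, by omega⟩
  -- Since R = 2^(2L), the interval splits into L blocks of ratio 4 inside (2^(18L), 2^(20L)], each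
  -- contributing at least 1/(4 · 20L).
  set L := 2 ^ k with hL
  have hL0 : 0 < L := by positivity
  have hr : 2 ^ (k + 1) = 2 * L := by rw [pow_succ]; ring
  have hbig : i₀ ≤ 18 * L := by
    have := Nat.lt_two_pow_self (n := k + 1)
    omega
  have key : ∀ l ≤ L, (l : ℝ) * (1 / (80 * L)) ≤
      ∑ p ∈ primesIoc (2 ^ (18 * L)) (2 ^ (18 * L + 2 * l)), (1 : ℝ) / p := by
    intro l
    induction l with
    | zero => intro _; simp [primesIoc]
    | succ l ih =>
      intro hl
      rw [sum_primesIoc_add _ (b := 2 ^ (18 * L + 2 * l))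
        (Nat.pow_le_pow_right (by norm_num) (by omega))
        (Nat.pow_le_pow_right (by norm_num) (by omega))]
      have h1 := hi₀ (18 * L + 2 * l) (by omega)
      have h2 : (1 : ℝ) / (80 * L) ≤ 1 / (4 * (((18 * L + 2 * l : ℕ) : ℝ) + 2)) := by
        refine one_div_le_one_div_of_le (by positivity) ?_
        have : ((l + 1 : ℕ) : ℝ) ≤ L := by exact_mod_cast hl
        push_cast at this ⊢
        linarith
      have h3 := ih (by omega)
      push_cast at h1 h2 ⊢
      rw [show 18 * L + 2 * (l + 1) = 18 * L + 2 * l + 2 by ring]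
      linarith
  have := key L le_rfl
  rw [hr, ← pow_mul, ← pow_mul, show 2 * L * 9 = 18 * L by ring,
    show 2 * L * 10 = 18 * L + 2 * L by ring]
  refine le_trans (le_of_eq ?_) this
  have : (L : ℝ) ≠ 0 := by exact_mod_cast hL0.ne'
  field_simp

/-! ### Energy and good points -/

/-- The logarithmic mean square of the partial sums below `M`. -/
noncomputable def energy (e : ℕ → Bool) (M : ℕ) : ℝ :=
  ∑ m ∈ Finset.Ico 1 M, rmfSum e m ^ 2 / (m : ℝ) ^ 2

/-- The points at which the part of `rmfSum` determined by the primes up to `R ^ 8` is dominated by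
the conditional standard deviation, the latter being not too small. -/
def goodSet (D : ℝ) (R : ℕ) (e : ℕ → Bool) : Set ℕ :=
  {n | n ∈ Finset.Ioc (R ^ 8) (R ^ 11) ∧
    smoothSum (R ^ 8) e n ^ 2 ≤ D ^ 2 * varSum (R ^ 8) e n ∧
    (4 * D + 4) ^ 2 * (R : ℝ) ^ 6 ≤ varSum (R ^ 8) e n}

theorem le_sq_of_mem_window {R n : ℕ} (h : n ∈ Finset.Ioc (R ^ 8) (R ^ 11)) :
    n ≤ (R ^ 8) ^ 2 := by
  have h' := Finset.mem_Ioc.mp h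
  have hR : 0 < R := by
    rcases Nat.eq_zero_or_pos R with rfl | h0
    · simp only [ne_eq, OfNat.ofNat_ne_zero, not_false_eq_true, zero_pow] at h'
      omega
    · exact h0
  rw [← pow_mul]
  exact h'.2.trans (Nat.pow_le_pow_right hR (by norm_num))

theorem dependsOn_goodSet (D : ℝ) (R : ℕ) : DependsOn (goodSet D R) (primesUpTo (R ^ 8)) := by
  intro e e' hee
  ext n
  refine and_congr_right fun hn => ?_
  have h1 : smoothSum (R ^ 8) e n = smoothSum (R ^ 8) e' n := dependsOn_smoothSum _ n hee
  have h2 : varSum (R ^ 8) e n = varSum (R ^ 8) e' n :=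
    dependsOn_varSum (le_sq_of_mem_window hn) hee
  rw [h1, h2]

theorem energy_mono (e : ℕ → Bool) : Monotone (energy e) := fun _ _ h =>
  Finset.sum_le_sum_of_subset_of_nonneg (Finset.Ico_subset_Ico le_rfl h)
    fun _ _ _ => by positivity

theorem one_le_energy (e : ℕ → Bool) {M : ℕ} (h : 2 ≤ M) : 1 ≤ energy e M := by
  refine le_trans (le_of_eq ?_) (energy_mono e h)
  simp [energy]

theorem dependsOn_energy {N M : ℕ} (h : M ≤ N + 1) :
    DependsOn (fun e => energy e M) (primesUpTo N) := by
  intro e e' hee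
  refine Finset.sum_congr rfl fun m hm => ?_
  have h1 : rmfSum e m = rmfSum e' m :=
    dependsOn_rmfSum (by have := Finset.mem_Ico.mp hm; omega) hee
  rw [h1]

/-- The quotient n/p equals m on a block of p integers n, each less than 2pm; this loses only the
factor 4. -/
theorem energy_div_le_sum (e : ℕ → Bool) {p : ℕ} (hp : 0 < p) {R : ℕ} (hR : 1 ≤ R) :
    1 / (4 * (p : ℝ)) * energy e R ≤
      ∑ n ∈ Finset.Ico p (R * p), rmfSum e (n / p) ^ 2 / (n : ℝ) ^ 2 := by
  induction R, hR using Nat.le_induction with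
  | base => simp [energy]
  | succ R hR ih =>
    rw [← Finset.sum_Ico_consecutive _ (Nat.le_mul_of_pos_left p hR)
      (Nat.mul_le_mul_right p (Nat.le_succ R)), energy, Finset.sum_Ico_succ_top hR, mul_add]
    refine add_le_add ih ?_
    have hterm : ∀ n ∈ Finset.Ico (R * p) ((R + 1) * p),
        rmfSum e R ^ 2 / (4 * (p : ℝ) ^ 2 * (R : ℝ) ^ 2) ≤
          rmfSum e (n / p) ^ 2 / (n : ℝ) ^ 2 := by
      intro n hn
      have hn' := Finset.mem_Ico.mp hn
      have hdiv : n / p = R := Nat.div_eq_of_lt_le hn'.1 hn'.2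
      have hn0 : (0 : ℝ) < n := by
        exact_mod_cast (Nat.mul_pos hR hp).trans_le hn'.1
      have hn2 : (n : ℝ) ≤ 2 * p * R := by
        have : n ≤ 2 * p * R := hn'.2.le.trans (by nlinarith)
        exact_mod_cast this
      rw [hdiv]
      refine div_le_div_of_nonneg_left (sq_nonneg _) (by positivity) ?_
      calc (n : ℝ) ^ 2 ≤ (2 * p * R) ^ 2 := by gcongr
        _ = _ := by ring
    refine le_trans (le_of_eq ?_) (Finset.card_nsmul_le_sum _ _ _ hterm)
    have hcard : (Finset.Ico (R * p) ((R + 1) * p)).card = p := by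
      rw [Nat.card_Ico, add_mul, one_mul, Nat.add_sub_cancel_left]
    have hp' : (p : ℝ) ≠ 0 := by exact_mod_cast hp.ne'
    have hR' : (R : ℝ) ≠ 0 := by exact_mod_cast (by omega : R ≠ 0)
    rw [hcard, nsmul_eq_mul]
    field_simp

/-- Only primes in (R^9, R^10] are kept in the variance: for them [p, Rp) lies inside the window, so
each prime sees the whole energy below R. -/
theorem sum_inv_mul_energy_le (e : ℕ → Bool) {R : ℕ} (hR : 1 ≤ R) :
    (∑ p ∈ primesIoc (R ^ 9) (R ^ 10), (1 : ℝ) / p) * (energy e R / 4) ≤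
      ∑ n ∈ Finset.Ioc (R ^ 8) (R ^ 11), varSum (R ^ 8) e n / (n : ℝ) ^ 2 := by
  classical
  have h89 : R ^ 8 ≤ R ^ 9 := Nat.pow_le_pow_right hR (by norm_num)
  calc (∑ p ∈ primesIoc (R ^ 9) (R ^ 10), (1 : ℝ) / p) * (energy e R / 4)
      = ∑ p ∈ primesIoc (R ^ 9) (R ^ 10), 1 / (4 * (p : ℝ)) * energy e R := by
        rw [Finset.sum_mul]
        refine Finset.sum_congr rfl fun p hp => ?_
        have : (p : ℝ) ≠ 0 := by exact_mod_cast (mem_primesIoc.mp hp).2.ne_zero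
        field_simp
    _ ≤ ∑ p ∈ primesIoc (R ^ 9) (R ^ 10),
          ∑ n ∈ Finset.Ico p (R * p), rmfSum e (n / p) ^ 2 / (n : ℝ) ^ 2 :=
        Finset.sum_le_sum fun p hp => energy_div_le_sum e (mem_primesIoc.mp hp).2.pos hR
    _ = ∑ p ∈ primesIoc (R ^ 9) (R ^ 10), ∑ n ∈ Finset.Ioc (R ^ 8) (R ^ 11),
          if n ∈ Finset.Ico p (R * p) then rmfSum e (n / p) ^ 2 / (n : ℝ) ^ 2 else 0 := by
        refine Finset.sum_congr rfl fun p hp => ?_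
        have hp' := mem_primesIoc.mp hp
        rw [← Finset.sum_filter]
        refine Finset.sum_congr ?_ fun _ _ => rfl
        ext n
        simp only [Finset.mem_filter, Finset.mem_Ioc, Finset.mem_Ico, iff_and_self]
        rintro ⟨h1, h2⟩
        refine ⟨by omega, h2.le.trans ?_⟩
        calc R * p ≤ R * R ^ 10 := Nat.mul_le_mul_left R hp'.1.2
          _ = R ^ 11 := by ring
    _ = ∑ n ∈ Finset.Ioc (R ^ 8) (R ^ 11), ∑ p ∈ primesIoc (R ^ 9) (R ^ 10),
          if n ∈ Finset.Ico p (R * p) then rmfSum e (n / p) ^ 2 / (n : ℝ) ^ 2 else 0 :=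
        Finset.sum_comm
    _ ≤ _ := by
        refine Finset.sum_le_sum fun n _ => ?_
        rw [← Finset.sum_filter, varSum, Finset.sum_div]
        refine Finset.sum_le_sum_of_subset_of_nonneg ?_ fun _ _ _ => by positivity
        intro p hp
        have hp1 := Finset.mem_filter.mp hp
        have hp2 := mem_primesIoc.mp hp1.1
        have hp3 := Finset.mem_Ico.mp hp1.2
        exact mem_primesIoc.mpr ⟨⟨by omega, hp3.1⟩, hp2.2⟩

theorem sum_inv_sq_Ioc_le {a : ℕ} (ha : 0 < a) (b : ℕ) :
    ∑ n ∈ Finset.Ioc a b, (1 : ℝ) / (n : ℝ) ^ 2 ≤ 1 / a := by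
  rcases le_total a b with h | h
  · have := sum_Ioc_inv_sq_le_sub (α := ℝ) ha.ne' h
    simp only [one_div]
    refine this.trans (sub_le_self _ (by positivity))
  · rw [Finset.Ioc_eq_empty (by omega)]
    simp

/-! ### Rademacher sums: moments and large deviations -/

namespace IsFairBits

variable {Ω : Type*} [MeasurableSpace Ω] {P : Measure Ω} [IsProbabilityMeasure P]
  {b : Ω → ℕ → Bool}

theorem integral_mul_bitSign (hb : IsFairBits P b) {p q : ℕ} (hp : p.Prime) (hq : q.Prime) :
    ∫ ω, bitSign (b ω p) * bitSign (b ω q) ∂P = if p = q then 1 else 0 := by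
  split_ifs with h
  · subst h
    simp [bitSign_mul_self]
  · have := hb.integral_prod {p, q} (by simp [hp, hq]) fun _ x => bitSign x
    simpa [Finset.prod_pair h] using this

theorem integral_sum_sq (hb : IsFairBits P b) (T : Finset ℕ) (hT : ∀ p ∈ T, p.Prime)
    (c : ℕ → ℝ) :
    ∫ ω, (∑ p ∈ T, bitSign (b ω p) * c p) ^ 2 ∂P = ∑ p ∈ T, c p ^ 2 := by
  have hint : ∀ p ∈ T, ∀ q ∈ T,
      Integrable (fun ω => c p * c q * (bitSign (b ω p) * bitSign (b ω q))) P := by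
    intro p hp q hq
    refine hb.integrable_comp (N := max p q)
      (φ := fun e => c p * c q * (bitSign (e p) * bitSign (e q))) ?_
    intro e e' h
    simp only [h p ⟨hT p hp, le_max_left _ _⟩, h q ⟨hT q hq, le_max_right _ _⟩]
  have hexp : ∀ ω, (∑ p ∈ T, bitSign (b ω p) * c p) ^ 2 =
      ∑ p ∈ T, ∑ q ∈ T, c p * c q * (bitSign (b ω p) * bitSign (b ω q)) := by
    intro ω
    rw [sq, Finset.sum_mul_sum]
    exact Finset.sum_congr rfl fun p _ => Finset.sum_congr rfl fun q _ => by ring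
  simp only [hexp]
  rw [integral_finsetSum _ fun p hp => integrable_finsetSum _ fun q hq => hint p hp q hq]
  refine Finset.sum_congr rfl fun p hp => ?_
  rw [integral_finsetSum _ fun q hq => hint p hp q hq]
  rw [Finset.sum_congr rfl fun q hq => by
    rw [integral_const_mul, hb.integral_mul_bitSign (hT p hp) (hT q hq)]]
  simp [hp, sq]

theorem integral_exp_sum (hb : IsFairBits P b) (T : Finset ℕ) (hT : ∀ p ∈ T, p.Prime)
    (c : ℕ → ℝ) (l : ℝ) :
    ∫ ω, Real.exp (l * ∑ p ∈ T, bitSign (b ω p) * c p) ∂P =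
      ∏ p ∈ T, Real.cosh (l * c p) := by
  have := hb.integral_prod T hT fun p x => Real.exp (l * (bitSign x * c p))
  simp only [← Real.exp_sum, ← Finset.mul_sum] at this
  rw [this]
  refine Finset.prod_congr rfl fun p _ => ?_
  rw [Real.cosh_eq]
  simp

theorem dependsOn_sum (T : Finset ℕ) (hT : ∀ p ∈ T, p.Prime) (c : ℕ → ℝ) :
    ∃ N, DependsOn (fun e : ℕ → Bool => ∑ p ∈ T, bitSign (e p) * c p) (primesUpTo N) := by
  refine ⟨T.sup id, fun e e' h => Finset.sum_congr rfl fun p hp => ?_⟩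
  rw [h p ⟨hT p hp, Finset.le_sup (f := id) hp⟩]

end IsFairBits

/-- Gives Rademacher sums with small coefficients a Gaussian lower bound on their exponential
moments. -/
theorem exp_quarter_sq_le_cosh {x : ℝ} (hx : x ^ 2 ≤ 1) : Real.exp (x ^ 2 / 4) ≤ Real.cosh x := by
  have h1 : 1 + x ^ 2 / 2 ≤ Real.cosh x := by
    have h := sum_le_hasSum (Finset.range 2) (fun n _ => by
      rw [pow_mul]; positivity) (Real.hasSum_cosh x)
    simpa [Finset.sum_range_succ] using h
  have h2 : Real.exp (x ^ 2 / 4) ≤ 1 + x ^ 2 / 2 := by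
    have h3 := Real.exp_bound_div_one_sub_of_interval (x := x ^ 2 / 4) (by positivity) (by linarith)
    refine h3.trans ?_
    rw [div_le_iff₀ (by linarith)]
    nlinarith [sq_nonneg x]
  exact h2.trans h1

namespace IsFairBits

variable {Ω : Type*} [MeasurableSpace Ω] {P : Measure Ω} [IsProbabilityMeasure P]
  {b : Ω → ℕ → Bool}

/-- A lower bound for large deviations of Rademacher sums without dominating terms. -/
theorem le_measureReal_sum_gt (hb : IsFairBits P b) {D : ℝ} (hD : 0 ≤ D) (T : Finset ℕ)
    (hT : ∀ p ∈ T, p.Prime) (c : ℕ → ℝ) {V : ℝ} (hV : V = ∑ p ∈ T, c p ^ 2) (hV0 : 0 < V)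
    (hc : ∀ p ∈ T, (4 * D + 4) ^ 2 * c p ^ 2 ≤ V) :
    Real.exp (-(3 / 2) * (4 * D + 4) ^ 2) / 4 ≤
      P.real {ω | D * √V < ∑ p ∈ T, bitSign (b ω p) * c p} := by
  set s : ℝ := 4 * D + 4 with hs
  set B : (ℕ → Bool) → ℝ := fun e => ∑ p ∈ T, bitSign (e p) * c p with hB
  obtain ⟨N, hN⟩ := dependsOn_sum T hT c
  have hsV : 0 < √V := Real.sqrt_pos.mpr hV0
  have hVV : √V * √V = V := Real.mul_self_sqrt hV0.le
  -- The tilt l makes l²V = s², and the hypothesis on the coefficients becomes (l c_p)² ≤ 1.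
  set l : ℝ := s / √V with hl
  have hl2 : l ^ 2 * V = s ^ 2 := by
    rw [hl, div_pow, sq (√V), hVV]
    field_simp
  set A : Set Ω := {ω | D * √V < B (b ω)} with hA
  have hAm : MeasurableSet A := hb.measurableSet_setOf (A := fun e => D * √V < B e) (N := N)
    fun e e' h => by
      have : B e = B e' := hN h
      simp only [this]
  set m : ℝ := Real.exp (s ^ 2 / 4) with hm
  set E : ℝ := Real.exp (2 * s ^ 2) with hE
  have hm0 : 0 < m := Real.exp_pos _
  have hE0 : 0 < E := Real.exp_pos _
  have h1 : m ≤ ∫ ω, Real.exp (l * B (b ω)) ∂P := by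
    rw [hb.integral_exp_sum T hT c l, hm]
    calc Real.exp (s ^ 2 / 4) = ∏ p ∈ T, Real.exp ((l * c p) ^ 2 / 4) := by
          rw [← Real.exp_sum, ← hl2, hV, Finset.mul_sum, Finset.sum_div]
          simp only [mul_pow]
      _ ≤ _ := by
          refine Finset.prod_le_prod (fun _ _ => (Real.exp_pos _).le) fun p hp => ?_
          refine exp_quarter_sq_le_cosh ?_
          rw [mul_pow, hl, div_pow, sq (√V), hVV, div_mul_eq_mul_div, div_le_one hV0]
          exact hc p hp
  have h2 : ∫ ω, Real.exp (2 * l * B (b ω)) ∂P ≤ E := by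
    rw [hb.integral_exp_sum T hT c (2 * l), hE]
    calc ∏ p ∈ T, Real.cosh (2 * l * c p) ≤ ∏ p ∈ T, Real.exp ((2 * l * c p) ^ 2 / 2) :=
          Finset.prod_le_prod (fun _ _ => (Real.cosh_pos _).le)
            fun p _ => Real.cosh_le_exp_half_sq _
      _ = Real.exp (2 * s ^ 2) := by
          rw [← Real.exp_sum, ← hl2, hV, Finset.mul_sum, Finset.mul_sum]
          congr 1
          exact Finset.sum_congr rfl fun p _ => by ring
  have hint : ∀ t : ℝ, Integrable (fun ω => Real.exp (t * B (b ω))) P := fun t =>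
    hb.integrable_comp (φ := fun e => Real.exp (t * B e)) (N := N) fun e e' h => by
      have : B e = B e' := hN h
      simp only [this]
  -- A Paley–Zygmund argument made pointwise. On A it is a completed square; off A, the choice s =
  -- 4(D + 1) gives m = exp(sD) exp(s), so the exponential is at most m/2. Integrated, it leaves m/4
  -- ≤ P(A) E/m.
  have hpt : ∀ ω, Real.exp (l * B (b ω)) ≤
      m / 2 + (m / (4 * E) * Real.exp (2 * l * B (b ω)) + A.indicator (fun _ => E / m) ω) := by
    intro ω
    have hsq : Real.exp (2 * l * B (b ω)) = Real.exp (l * B (b ω)) ^ 2 := by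
      rw [← Real.exp_nat_mul]; congr 1; push_cast; ring
    rw [hsq]
    set Z := Real.exp (l * B (b ω)) with hZ
    by_cases hω : ω ∈ A
    · rw [Set.indicator_of_mem hω]
      have : 0 ≤ m / (4 * E) * (Z - 2 * E / m) ^ 2 := by positivity
      have h3 : m / (4 * E) * (Z - 2 * E / m) ^ 2 = m / (4 * E) * Z ^ 2 - Z + E / m := by
        field_simp
        ring
      linarith
    · rw [Set.indicator_of_notMem hω]
      have hle : B (b ω) ≤ D * √V := not_lt.mp hω
      have h3 : Z ≤ m / 2 := by
        have h4 : l * B (b ω) ≤ s * D := by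
          calc l * B (b ω) ≤ l * (D * √V) := by gcongr
            _ = s * D := by rw [hl]; field_simp
        have h5 : Z ≤ Real.exp (s * D) := Real.exp_le_exp.mpr h4
        have h6 : m = Real.exp (s * D) * Real.exp s := by
          rw [hm, ← Real.exp_add]; congr 1; rw [hs]; ring
        have h7 : 2 ≤ Real.exp s := by
          have := Real.add_one_le_exp s
          linarith
        have := Real.exp_pos (s * D)
        nlinarith
      have : 0 ≤ m / (4 * E) * Z ^ 2 := by positivity
      linarith
  have hI2 : Integrable (fun ω => m / (4 * E) * Real.exp (2 * l * B (b ω))) P :=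
    (hint (2 * l)).const_mul _
  have hI3 : Integrable (A.indicator (fun _ => E / m)) P := (integrable_const _).indicator hAm
  have h4 := integral_mono (hint l) ((integrable_const (m / 2)).add (hI2.add hI3)) hpt
  have h5 : ∫ ω, (m / 2 + (m / (4 * E) * Real.exp (2 * l * B (b ω)) +
      A.indicator (fun _ => E / m) ω)) ∂P =
      m / 2 + (m / (4 * E) * ∫ ω, Real.exp (2 * l * B (b ω)) ∂P + P.real A * (E / m)) := by
    have e1 := integral_add (μ := P) (integrable_const (m / 2)) (hI2.add hI3)
    have e2 := integral_add (μ := P) hI2 hI3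
    have e3 := integral_indicator_const (μ := P) (E / m) hAm
    simp only [Pi.add_apply] at e1
    rw [e1, e2, e3, integral_const_mul]
    simp
  have h6 : m / (4 * E) * ∫ ω, Real.exp (2 * l * B (b ω)) ∂P ≤ m / 4 := by
    calc _ ≤ m / (4 * E) * E := by gcongr
      _ = m / 4 := by field_simp
  have h7 : m / 4 ≤ P.real A * (E / m) := by
    have h4' := h4.trans_eq h5
    linarith
  have h8 : Real.exp (-(3 / 2) * s ^ 2) = m * m / E := by
    rw [hm, hE, ← Real.exp_add, ← Real.exp_sub]; congr 1; ring
  rw [h8]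
  have h9 : m * m / E / 4 = m / 4 * (m / E) := by field_simp
  calc m * m / E / 4 = m / 4 * (m / E) := h9
    _ ≤ P.real A * (E / m) * (m / E) := by gcongr
    _ = P.real A := by field_simp

/-- At a good point, both signs have positive conditional probability. -/
theorem le_measureReal_sign (hb : IsFairBits P b) {D : ℝ} (hD : 0 ≤ D) {R n : ℕ}
    {u : ℕ → Bool} (hn : n ∈ goodSet D R u) {σ : ℝ} (hσ : σ ^ 2 = 1) :
    Real.exp (-(3 / 2) * (4 * D + 4) ^ 2) / 4 ≤
      P.real {ω | 0 < σ * rmfSum (mix (R ^ 8) u (b ω)) n} := by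
  obtain ⟨hw, h1, h2⟩ := hn
  have hnR := le_sq_of_mem_window hw
  have hw' := Finset.mem_Ioc.mp hw
  have hR : 0 < R := by
    by_contra h0
    obtain rfl : R = 0 := by omega
    simp only [ne_eq, OfNat.ofNat_ne_zero, not_false_eq_true, zero_pow] at hw'
    omega
  have hR' : (0 : ℝ) < R := by exact_mod_cast hR
  set V := varSum (R ^ 8) u n with hV
  have hV0 : 0 < V := lt_of_lt_of_le (by positivity) h2
  have key := hb.le_measureReal_sum_gt hD (primesIoc (R ^ 8) n)
    (fun p hp => (mem_primesIoc.mp hp).2) (fun p => σ * rmfSum u (n / p)) (V := V)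
    (by simp only [mul_pow, hσ, one_mul]; rfl) hV0 (by
      intro p hp
      refine le_trans ?_ h2
      rw [mul_pow, hσ, one_mul]
      -- This is the origin of R^6 in `goodSet`: n ≤ R^11 and p > R^8 bound each coefficient by R^3.
      have h3 : n / p ≤ R ^ 3 := by
        refine Nat.div_le_of_le_mul (hw'.2.trans ?_)
        calc R ^ 11 = R ^ 8 * R ^ 3 := by ring
          _ ≤ p * R ^ 3 := Nat.mul_le_mul_right _ (mem_primesIoc.mp hp).1.1.le
      have h4 : |rmfSum u (n / p)| ≤ (R : ℝ) ^ 3 :=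
        (abs_rmfSum_le u (n / p)).trans (by exact_mod_cast h3)
      have h5 : rmfSum u (n / p) ^ 2 ≤ (R : ℝ) ^ 6 := by
        rw [← sq_abs]
        calc |rmfSum u (n / p)| ^ 2 ≤ ((R : ℝ) ^ 3) ^ 2 := by gcongr
          _ = _ := by ring
      gcongr)
  refine key.trans (measureReal_mono fun ω hω => ?_)
  simp only [Set.mem_ofPred_eq] at hω ⊢
  rw [rmfSum_mix hnR, mul_add]
  have h3 : ∑ p ∈ primesIoc (R ^ 8) n, bitSign (b ω p) * (σ * rmfSum u (n / p)) =
      σ * ∑ p ∈ primesIoc (R ^ 8) n, bitSign (b ω p) * rmfSum u (n / p) := by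
    rw [Finset.mul_sum]
    exact Finset.sum_congr rfl fun p _ => by ring
  rw [h3] at hω
  -- The smooth part is at most D√V in size, so a fresh sum above D√V decides the sign.
  have h4 : |σ * smoothSum (R ^ 8) u n| ≤ D * √V := by
    refine abs_le_of_sq_le_sq ?_ (by positivity)
    rw [mul_pow, hσ, one_mul, mul_pow, Real.sq_sqrt hV0.le]
    exact h1
  have := (abs_le.mp h4).1
  linarith

/-! ### Energy growth in the absence of good points -/

/-- Without a good point, the energy grows with high conditional probability. -/
theorem measureReal_not_growth_le (hb : IsFairBits P b) {D : ℝ} (hD : 0 < D) {R : ℕ}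
    (hR : 2 ≤ R) (hRD : 640 * (4 * D + 4) ^ 2 ≤ (R : ℝ) ^ 2)
    (hprimes : (1 : ℝ) / 80 ≤ ∑ p ∈ primesIoc (R ^ 9) (R ^ 10), (1 : ℝ) / p)
    {u : ℕ → Bool} (hu : goodSet D R u = ∅) :
    P.real {ω | ¬ D ^ 2 / 2560 * energy u R ≤ energy (mix (R ^ 8) u (b ω)) (R ^ 16)} ≤
      8 / D ^ 2 := by
  set W := Finset.Ioc (R ^ 8) (R ^ 11) with hW
  set T := ∑ n ∈ W, varSum (R ^ 8) u n / (n : ℝ) ^ 2 with hT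
  set A := ∑ n ∈ W, smoothSum (R ^ 8) u n ^ 2 / (n : ℝ) ^ 2 with hA
  have hR0 : (0 : ℝ) < R := by exact_mod_cast (by omega : 0 < R)
  have he1 := one_le_energy u hR
  have hTe : energy u R / 320 ≤ T := by
    refine le_trans ?_ (sum_inv_mul_energy_le u (by omega : 1 ≤ R))
    calc energy u R / 320 = 1 / 80 * (energy u R / 4) := by ring
      _ ≤ _ := by gcongr
  have hT0 : 0 < T := by linarith
  -- At a point that is not good, either the smooth part dominates or the variance is below the
  -- threshold. The latter points cost at most half of T, because T ≥ 1/320 and R² ≥ 640 (4D + 4)².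
  have hAT : D ^ 2 / 2 * T ≤ A := by
    have h1 : ∀ n ∈ W, D ^ 2 * varSum (R ^ 8) u n ≤
        smoothSum (R ^ 8) u n ^ 2 + D ^ 2 * ((4 * D + 4) ^ 2 * (R : ℝ) ^ 6) := by
      intro n hn
      have hnot : n ∉ goodSet D R u := by rw [hu]; exact Set.notMem_empty n
      by_cases h : smoothSum (R ^ 8) u n ^ 2 ≤ D ^ 2 * varSum (R ^ 8) u n
      · have h2 : varSum (R ^ 8) u n ≤ (4 * D + 4) ^ 2 * (R : ℝ) ^ 6 :=
          (not_le.mp fun h' => hnot ⟨hn, h, h'⟩).le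
        have h3 := mul_le_mul_of_nonneg_left h2 (sq_nonneg D)
        have := sq_nonneg (smoothSum (R ^ 8) u n)
        linarith
      · have : 0 ≤ D ^ 2 * ((4 * D + 4) ^ 2 * (R : ℝ) ^ 6) := by positivity
        linarith [not_le.mp h]
    have h2 : D ^ 2 * T ≤
        A + D ^ 2 * ((4 * D + 4) ^ 2 * (R : ℝ) ^ 6) * ∑ n ∈ W, 1 / (n : ℝ) ^ 2 := by
      rw [hT, hA, Finset.mul_sum, Finset.mul_sum, ← Finset.sum_add_distrib]
      refine Finset.sum_le_sum fun n hn => ?_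
      have := div_le_div_of_nonneg_right (h1 n hn) (sq_nonneg (n : ℝ))
      calc D ^ 2 * (varSum (R ^ 8) u n / (n : ℝ) ^ 2) =
            D ^ 2 * varSum (R ^ 8) u n / (n : ℝ) ^ 2 := by ring
        _ ≤ _ := this
        _ = _ := by ring
    have h3 : ((4 * D + 4) ^ 2 * (R : ℝ) ^ 6) * ∑ n ∈ W, 1 / (n : ℝ) ^ 2 ≤ T / 2 := by
      have h4 := sum_inv_sq_Ioc_le (a := R ^ 8) (by positivity) (R ^ 11)
      calc ((4 * D + 4) ^ 2 * (R : ℝ) ^ 6) * ∑ n ∈ W, 1 / (n : ℝ) ^ 2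
          ≤ ((4 * D + 4) ^ 2 * (R : ℝ) ^ 6) * (1 / ((R ^ 8 : ℕ) : ℝ)) := by gcongr
        _ = (4 * D + 4) ^ 2 / (R : ℝ) ^ 2 := by
            push_cast
            field_simp
        _ ≤ 1 / 640 := by
            rw [div_le_div_iff₀ (by positivity) (by norm_num)]
            linarith
        _ ≤ T / 2 := by linarith
    have h5 := mul_le_mul_of_nonneg_left h3 (sq_nonneg D)
    rw [← mul_assoc] at h5
    linarith
  set B : ℕ → (ℕ → Bool) → ℝ :=
    fun n e => ∑ p ∈ primesIoc (R ^ 8) n, bitSign (e p) * rmfSum u (n / p) with hB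
  have hBdep : ∀ n ∈ W, DependsOn (fun e => B n e ^ 2 / (n : ℝ) ^ 2) (primesUpTo (R ^ 11)) := by
    intro n hn e e' h
    have : B n e = B n e' := Finset.sum_congr rfl fun p hp => by
      have hp' := mem_primesIoc.mp hp
      rw [h p ⟨hp'.2, hp'.1.2.trans (Finset.mem_Ioc.mp hn).2⟩]
    simp only [this]
  have hBint : ∀ n ∈ W, Integrable (fun ω => B n (b ω) ^ 2 / (n : ℝ) ^ 2) P := fun n hn =>
    hb.integrable_comp (hBdep n hn)
  set Y : Ω → ℝ := fun ω => ∑ n ∈ W, B n (b ω) ^ 2 / (n : ℝ) ^ 2 with hY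
  have hYint : Integrable Y P := integrable_finsetSum _ hBint
  have hYval : ∫ ω, Y ω ∂P = T := by
    rw [hY, integral_finsetSum _ hBint]
    refine Finset.sum_congr rfl fun n _ => ?_
    rw [integral_div, hb.integral_sum_sq _ fun p hp => (mem_primesIoc.mp hp).2]
    rfl
  -- Without growth the energy is below (D²/8)T, as 2560 = 8 · 320, whereas it is at least A/2 - Y
  -- with A/2 ≥ (D²/4)T. So Y ≥ (D²/8)T although its mean is T, and Markov's inequality applies.
  have hsub : {ω | ¬ D ^ 2 / 2560 * energy u R ≤ energy (mix (R ^ 8) u (b ω)) (R ^ 16)} ⊆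
      {ω | D ^ 2 / 8 * T ≤ Y ω} := by
    intro ω hω
    simp only [Set.mem_ofPred_eq, not_le] at hω ⊢
    have h1 : A / 2 - Y ω ≤ energy (mix (R ^ 8) u (b ω)) (R ^ 16) := by
      calc A / 2 - Y ω ≤ ∑ n ∈ W, rmfSum (mix (R ^ 8) u (b ω)) n ^ 2 / (n : ℝ) ^ 2 := by
            rw [hA, hY, Finset.sum_div, ← Finset.sum_sub_distrib]
            refine Finset.sum_le_sum fun n hn => ?_
            rw [rmfSum_mix (le_sq_of_mem_window hn)]
            change smoothSum (R ^ 8) u n ^ 2 / (n : ℝ) ^ 2 / 2 - B n (b ω) ^ 2 / (n : ℝ) ^ 2 ≤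
              (smoothSum (R ^ 8) u n + B n (b ω)) ^ 2 / (n : ℝ) ^ 2
            rw [div_right_comm, ← sub_div]
            refine div_le_div_of_nonneg_right ?_ (sq_nonneg _)
            -- This is (x + y)² - x²/2 + y² = (x + 2y)²/2 ≥ 0.
            nlinarith [sq_nonneg (smoothSum (R ^ 8) u n + 2 * B n (b ω))]
        _ ≤ _ := by
            refine Finset.sum_le_sum_of_subset_of_nonneg ?_ fun _ _ _ => by positivity
            intro n hn
            have hn' := Finset.mem_Ioc.mp hn
            have : R ^ 11 < R ^ 16 := Nat.pow_lt_pow_right (by omega) (by norm_num)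
            exact Finset.mem_Ico.mpr ⟨by omega, by omega⟩
    nlinarith [sq_nonneg D, mul_le_mul_of_nonneg_left hTe (sq_nonneg D)]
  have hmark := mul_meas_ge_le_integral_of_nonneg (μ := P) (f := Y)
    (ae_of_all _ fun ω => Finset.sum_nonneg fun n _ => by positivity) hYint (D ^ 2 / 8 * T)
  rw [hYval] at hmark
  have h1 : P.real {ω | D ^ 2 / 8 * T ≤ Y ω} ≤ 8 / D ^ 2 := by
    rw [le_div_iff₀ (by positivity)]
    have : D ^ 2 / 8 * T * P.real {ω | D ^ 2 / 8 * T ≤ Y ω} ≤ T := hmark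
    have h2 : (P.real {ω | D ^ 2 / 8 * T ≤ Y ω} * D ^ 2 / 8) * T ≤ 1 * T := by linarith
    have := le_of_mul_le_mul_right h2 hT0
    linarith
  exact (measureReal_mono hsub).trans h1

end IsFairBits

/-! ### Almost sure growth bounds -/

/-- The series ∑ ρ^(-k) Y_k has finite expectation, hence converges almost surely and its terms tend
to zero. -/
theorem ae_eventually_le_pow {Ω : Type*} [MeasurableSpace Ω] {P : Measure Ω}
    {Y : ℕ → Ω → ℝ≥0∞} (hY : ∀ k, Measurable (Y k)) {C : ℝ≥0∞} (hC : C ≠ ∞)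
    (hYC : ∀ k, ∫⁻ ω, Y k ω ∂P ≤ C) {ρ : ℝ≥0∞} (hρ : 1 < ρ) (hρ' : ρ ≠ ∞) :
    ∀ᵐ ω ∂P, ∀ᶠ k in atTop, Y k ω ≤ ρ ^ k := by
  have hρ0 : ρ ≠ 0 := (zero_lt_one.trans hρ).ne'
  have hr : ρ⁻¹ < 1 := ENNReal.inv_lt_one.mpr hρ
  have hm : ∀ k, AEMeasurable (fun ω => ρ⁻¹ ^ k * Y k ω) P := fun k =>
    ((hY k).const_mul _).aemeasurable
  have hfin : ∫⁻ ω, ∑' k, ρ⁻¹ ^ k * Y k ω ∂P ≠ ∞ := by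
    rw [lintegral_tsum hm]
    refine ne_top_of_le_ne_top ?_ (ENNReal.tsum_le_tsum (g := fun k => ρ⁻¹ ^ k * C) fun k => ?_)
    · rw [ENNReal.tsum_mul_right, ENNReal.tsum_geometric]
      exact ENNReal.mul_ne_top (ENNReal.inv_ne_top.mpr (tsub_pos_of_lt hr).ne') hC
    · rw [lintegral_const_mul _ (hY k)]
      gcongr
      exact hYC k
  filter_upwards [ae_lt_top' (AEMeasurable.tsum hm) hfin] with ω hω
  have ht := ENNReal.tendsto_atTop_zero_of_tsum_ne_top hω.ne
  filter_upwards [ht.eventually_lt_const zero_lt_one] with k hk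
  rw [← ENNReal.inv_pow, mul_comm, ← div_eq_mul_inv] at hk
  have := (ENNReal.div_le_iff (pow_ne_zero k hρ0) (ENNReal.pow_ne_top hρ')).mp hk.le
  simpa using this

theorem rmf_eq_prod (e : ℕ → Bool) {n : ℕ} (hn : Squarefree n) {U : Finset ℕ}
    (hU : n.primeFactors ⊆ U) :
    rmf e n = ∏ p ∈ U, if p ∈ n.primeFactors then bitSign (e p) else 1 := by
  rw [rmf, if_pos hn, Finset.prod_ite_mem, Finset.inter_eq_right.mpr hU]

theorem dependsOn_rmf (n : ℕ) : DependsOn (fun e => rmf e n) (primesUpTo n) :=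
  fun _ _ h => rmf_congr fun p hp =>
    h p ⟨Nat.prime_of_mem_primeFactors hp, Nat.le_of_mem_primeFactors hp⟩

namespace IsFairBits

variable {Ω : Type*} [MeasurableSpace Ω] {P : Measure Ω} [IsProbabilityMeasure P]
  {b : Ω → ℕ → Bool}

/-- Distinct squarefree integers differ at some prime, which divides exactly one of them and
contributes a factor of mean zero. -/
theorem integral_rmf_mul_rmf (hb : IsFairBits P b) {m n : ℕ} (hmn : m ≠ n) :
    ∫ ω, rmf (b ω) m * rmf (b ω) n ∂P = 0 := by
  by_cases hm : Squarefree m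
  swap
  · simp [rmf, hm]
  by_cases hn : Squarefree n
  swap
  · simp [rmf, hn]
  have hprod : ∀ e, rmf e m * rmf e n = ∏ p ∈ m.primeFactors ∪ n.primeFactors,
      ((if p ∈ m.primeFactors then bitSign (e p) else 1) *
        (if p ∈ n.primeFactors then bitSign (e p) else 1)) := by
    intro e
    rw [rmf_eq_prod e hm Finset.subset_union_left, rmf_eq_prod e hn Finset.subset_union_right,
      Finset.prod_mul_distrib]
  have hpr : ∀ p ∈ m.primeFactors ∪ n.primeFactors, p.Prime := fun p hp =>
    (Finset.mem_union.mp hp).elim Nat.prime_of_mem_primeFactors Nat.prime_of_mem_primeFactors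
  simp only [hprod]
  rw [hb.integral_prod _ hpr fun p x => (if p ∈ m.primeFactors then bitSign x else 1) *
        (if p ∈ n.primeFactors then bitSign x else 1)]
  have hne : m.primeFactors ≠ n.primeFactors := fun h => hmn <| by
    rw [← Nat.prod_primeFactors_of_squarefree hm, ← Nat.prod_primeFactors_of_squarefree hn, h]
  obtain ⟨p, hp⟩ : ∃ p, ¬ (p ∈ m.primeFactors ↔ p ∈ n.primeFactors) := by
    by_contra h
    push Not at h
    exact hne (Finset.ext h)
  by_cases h1 : p ∈ m.primeFactors
  · have h2 : p ∉ n.primeFactors := fun h2 => hp ⟨fun _ => h2, fun _ => h1⟩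
    refine Finset.prod_eq_zero (Finset.mem_union_left _ h1) ?_
    rw [if_pos h1, if_neg h2, if_pos h1, if_neg h2]
    simp
  · have h2 : p ∈ n.primeFactors := by
      by_contra h2
      exact hp ⟨fun h => absurd h h1, fun h => absurd h h2⟩
    refine Finset.prod_eq_zero (Finset.mem_union_right _ h2) ?_
    rw [if_neg h1, if_pos h2, if_neg h1, if_pos h2]
    simp

theorem integral_rmfSum_sq_le (hb : IsFairBits P b) (n : ℕ) :
    ∫ ω, rmfSum (b ω) n ^ 2 ∂P ≤ n := by
  have hint : ∀ i j, Integrable (fun ω => rmf (b ω) i * rmf (b ω) j) P := fun i j =>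
    hb.integrable_comp (φ := fun e => rmf e i * rmf e j) (N := max i j) fun e e' h => by
      have h1 : rmf e i = rmf e' i :=
        ((dependsOn_rmf i).mono (primesUpTo_mono (le_max_left i j))) h
      have h2 : rmf e j = rmf e' j :=
        ((dependsOn_rmf j).mono (primesUpTo_mono (le_max_right i j))) h
      simp only [h1, h2]
  simp only [rmfSum, sq, Finset.sum_mul_sum]
  rw [integral_finsetSum _ fun i _ => integrable_finsetSum _ fun j _ => hint i j]
  calc ∑ i ∈ Finset.Icc 1 n, ∫ ω, ∑ j ∈ Finset.Icc 1 n, rmf (b ω) i * rmf (b ω) j ∂P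
      ≤ ∑ i ∈ Finset.Icc 1 n, (1 : ℝ) := by
        refine Finset.sum_le_sum fun i hi => ?_
        rw [integral_finsetSum _ fun j _ => hint i j,
          Finset.sum_eq_single_of_mem i hi fun j _ hj => hb.integral_rmf_mul_rmf hj.symm]
        calc ∫ ω, rmf (b ω) i * rmf (b ω) i ∂P ≤ ∫ _, (1 : ℝ) ∂P := by
              refine integral_mono (hint i i) (integrable_const 1) fun ω => ?_
              have := abs_le.mp (abs_rmf_le_one (b ω) i)
              nlinarith
          _ = 1 := by simp
    _ = n := by simp

/-- Since M(m)² has mean at most m, the expected energy is bounded by a harmonic sum, of size about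
2^k log 2. -/
theorem integral_energy_le (hb : IsFairBits P b) (k : ℕ) :
    ∫ ω, energy (b ω) (2 ^ 2 ^ k) ∂P ≤ 2 * 2 ^ k := by
  have hint : ∀ m, Integrable (fun ω => rmfSum (b ω) m ^ 2 / (m : ℝ) ^ 2) P := fun m =>
    hb.integrable_comp (φ := fun e => rmfSum e m ^ 2 / (m : ℝ) ^ 2) (N := m) fun e e' h => by
      have h1 : rmfSum e m = rmfSum e' m := dependsOn_rmfSum le_rfl h
      simp only [h1]
  simp only [energy]
  rw [integral_finsetSum _ fun m _ => hint m]
  calc ∑ m ∈ Finset.Ico 1 (2 ^ 2 ^ k), ∫ ω, rmfSum (b ω) m ^ 2 / (m : ℝ) ^ 2 ∂P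
      ≤ ∑ m ∈ Finset.Ico 1 (2 ^ 2 ^ k), ((m : ℕ) : ℝ)⁻¹ := by
        refine Finset.sum_le_sum fun m hm => ?_
        have hm0 : (0 : ℝ) < m := by exact_mod_cast (Finset.mem_Ico.mp hm).1
        rw [integral_div, div_le_iff₀ (by positivity)]
        refine (hb.integral_rmfSum_sq_le m).trans (le_of_eq ?_)
        field_simp
    _ ≤ ∑ m ∈ Finset.Icc 1 (2 ^ 2 ^ k), ((m : ℕ) : ℝ)⁻¹ :=
        Finset.sum_le_sum_of_subset_of_nonneg (fun m hm => by
          have := Finset.mem_Ico.mp hm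
          exact Finset.mem_Icc.mpr ⟨this.1, this.2.le⟩) fun _ _ _ => by positivity
    _ ≤ 1 + Real.log ((2 ^ 2 ^ k : ℕ) : ℝ) := by
        have := harmonic_le_one_add_log (2 ^ 2 ^ k)
        rw [harmonic_eq_sum_Icc] at this
        push_cast at this ⊢
        exact this
    _ ≤ 2 * 2 ^ k := by
        push_cast
        rw [Real.log_pow]
        push_cast
        have h1 := Real.log_two_lt_d9
        have h2 : (1 : ℝ) ≤ 2 ^ k := one_le_pow₀ one_le_two
        nlinarith

theorem ae_eventually_energy_le (hb : IsFairBits P b) :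
    ∀ᵐ ω ∂P, ∀ᶠ k : ℕ in atTop, energy (b ω) (2 ^ 2 ^ k) ≤ 4 ^ k := by
  have hdep : ∀ k : ℕ, DependsOn (fun e => energy e (2 ^ 2 ^ k)) (primesUpTo (2 ^ 2 ^ k)) :=
    fun k => dependsOn_energy (Nat.le_succ _)
  have hnn : ∀ e M, 0 ≤ energy e M := fun e M => Finset.sum_nonneg fun _ _ => by positivity
  have h := ae_eventually_le_pow (P := P)
    (Y := fun k ω => ENNReal.ofReal (energy (b ω) (2 ^ 2 ^ k) / 2 ^ k)) (fun k =>
      ((hb.measurable_comp (hdep k)).div_const _).ennreal_ofReal) (C := 2) (by simp) (fun k => by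
      rw [← ofReal_integral_eq_lintegral_ofReal ((hb.integrable_comp (hdep k)).div_const _)
        (ae_of_all _ fun ω => div_nonneg (hnn _ _) (by positivity)), integral_div]
      rw [← ENNReal.ofReal_ofNat 2]
      refine ENNReal.ofReal_le_ofReal ?_
      rw [div_le_iff₀ (by positivity)]
      exact hb.integral_energy_le k) (ρ := 2) (by norm_num) (by simp)
  filter_upwards [h] with ω hω
  filter_upwards [hω] with k hk
  rw [← ENNReal.ofReal_ofNat 2, ← ENNReal.ofReal_pow (by norm_num),
    ENNReal.ofReal_le_ofReal_iff (by positivity), div_le_iff₀ (by positivity), ← mul_pow] at hk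
  norm_num at hk
  exact hk

/-- Products of factors of conditional mean at most one grow subexponentially. -/
theorem ae_eventually_prod_le (hb : IsFairBits P b) {N : ℕ → ℕ} (hN : Monotone N)
    {X : ℕ → (ℕ → Bool) → ℝ≥0∞} (hX : ∀ k, DependsOn (X k) (primesUpTo (N (k + 1))))
    (hmean : ∀ k u, ∫⁻ ω, X k (mix (N k) u (b ω)) ∂P ≤ 1) {ρ : ℝ≥0∞} (hρ : 1 < ρ)
    (hρ' : ρ ≠ ∞) :
    ∀ᵐ ω ∂P, ∀ᶠ K in atTop, ∏ k ∈ Finset.range K, X k (b ω) ≤ ρ ^ K := by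
  have hdep : ∀ K, DependsOn (fun e => ∏ k ∈ Finset.range K, X k e) (primesUpTo (N K)) := by
    intro K e e' h
    refine Finset.prod_congr rfl fun k hk => ?_
    exact (hX k).mono (primesUpTo_mono (hN (Finset.mem_range.mp hk))) h
  refine ae_eventually_le_pow (fun K => hb.measurable_comp (hdep K)) ENNReal.one_ne_top
    (fun K => ?_) hρ hρ'
  induction K with
  | zero => simp
  | succ K ih =>
    -- Supermartingale step: the first K factors are frozen and the last one has conditional mean at
    -- most 1.
    rw [hb.lintegral_resample (hdep (K + 1)) (N K)]
    refine le_trans (lintegral_mono fun ω => ?_) ih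
    have h1 : ∀ ω', ∏ k ∈ Finset.range (K + 1), X k (mix (N K) (b ω) (b ω')) =
        (∏ k ∈ Finset.range K, X k (b ω)) * X K (mix (N K) (b ω) (b ω')) := by
      intro ω'
      rw [Finset.prod_range_succ]
      congr 1
      exact (hdep K).mix_eq (b ω) (b ω')
    simp only [h1]
    rw [lintegral_const_mul _ (hb.measurable_comp ((hX K).mix_right (N K) (b ω)))]
    calc _ ≤ (∏ k ∈ Finset.range K, X k (b ω)) * 1 := by
          gcongr
          exact hmean K (b ω)
      _ = _ := mul_one _

end IsFairBits

theorem lintegral_ite_ofReal {Ω : Type*} [MeasurableSpace Ω] {P : Measure Ω}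
    [IsProbabilityMeasure P] {A : Ω → Prop} [DecidablePred A] (hA : MeasurableSet {ω | A ω})
    {x y : ℝ} (hx : 0 ≤ x) (hy : 0 ≤ y) :
    ∫⁻ ω, (if A ω then ENNReal.ofReal x else ENNReal.ofReal y) ∂P =
      ENNReal.ofReal (x * P.real {ω | A ω} + y * (1 - P.real {ω | A ω})) := by
  have h1 : ∀ ω, (if A ω then ENNReal.ofReal x else ENNReal.ofReal y) =
      {ω | A ω}.indicator (fun _ => ENNReal.ofReal x) ω +
        {ω | A ω}ᶜ.indicator (fun _ => ENNReal.ofReal y) ω := by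
    intro ω
    by_cases h : A ω <;> simp [h, Set.indicator]
  simp only [h1]
  rw [lintegral_add_left (measurable_const.indicator hA), lintegral_indicator_const hA,
    lintegral_indicator_const hA.compl, ← ofReal_measureReal, ← ofReal_measureReal,
    measureReal_compl hA, ← ENNReal.ofReal_mul hx, ← ENNReal.ofReal_mul hy,
    ← ENNReal.ofReal_add (by positivity)]
  · simp
  · refine mul_nonneg hy ?_
    simp [measureReal_le_one]

/-! ### Scales and alternating signs -/

/-- The scales at which the primes are revealed. -/
def scale (j : ℕ) : ℕ := 2 ^ 2 ^ j

theorem two_le_scale (j : ℕ) : 2 ≤ scale j :=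
  Nat.le_self_pow (pow_pos two_pos j).ne' 2

theorem scale_add (i j : ℕ) : scale (j + i) = scale j ^ 2 ^ i := by
  rw [scale, scale, ← pow_mul, ← pow_add]

theorem scale_succ_pow (j : ℕ) : scale (j + 1) ^ 8 = scale j ^ 16 := by
  rw [scale_add, ← pow_mul]
  norm_num

theorem monotone_scale_pow : Monotone fun j => scale j ^ 8 := fun _ _ h =>
  Nat.pow_le_pow_left (Nat.pow_le_pow_right two_pos (Nat.pow_le_pow_right two_pos h)) 8

open Classical in
/-- The number of steps, among the first `k`, at which the first good point shows the sign opposite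
to that of the previous such step. -/
noncomputable def altCount (D : ℝ) : ℕ → (ℕ → Bool) → ℕ
  | 0, _ => 0
  | k + 1, e => altCount D k e +
      if (goodSet D (scale k) e).Nonempty ∧
        0 < (-1) ^ altCount D k e * rmfSum e (sInf (goodSet D (scale k) e)) then 1 else 0

/-- The count is adapted to the revealed primes: points used at step k are at most R^11, below R^16,
the next level of revelation. -/
theorem dependsOn_altCount (D : ℝ) (k : ℕ) :
    DependsOn (altCount D k) (primesUpTo (scale k ^ 8)) := by
  classical
  induction k with
  | zero => intro _ _ _; rfl
  | succ k ih =>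
    intro e e' h
    have hmono := primesUpTo_mono (monotone_scale_pow (Nat.le_succ k))
    have h1 := ih.mono hmono h
    have h2 := (dependsOn_goodSet D (scale k)).mono hmono h
    rw [altCount, altCount]
    refine congrArg₂ (· + ·) h1 ?_
    refine if_congr ?_ rfl rfl
    rw [h1, h2]
    by_cases hne : (goodSet D (scale k) e').Nonempty
    · have h3 : rmfSum e (sInf (goodSet D (scale k) e')) =
          rmfSum e' (sInf (goodSet D (scale k) e')) := by
        refine dependsOn_rmfSum ?_ h
        refine (Finset.mem_Ioc.mp (Nat.sInf_mem hne).1).2.trans ?_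
        rw [scale_succ_pow]
        exact Nat.pow_le_pow_right (by linarith [two_le_scale k]) (by norm_num)
      rw [h3]
    · simp only [hne, false_and]

/-- A point added at step k exceeds `scale k ^ 8`, which bounds all earlier ones, so the points
increase strictly. -/
theorem exists_alternating_points (D : ℝ) (e : ℕ → Bool) (k : ℕ) :
    ∃ q : ℕ → ℕ, (∀ i < altCount D k e, 1 ≤ q i ∧ q i ≤ scale k ^ 8 ∧
      0 < (-1) ^ i * rmfSum e (q i)) ∧ ∀ i j, i < j → j < altCount D k e → q i < q j := by
  classical
  induction k with
  | zero => exact ⟨id, by simp [altCount], by simp [altCount]⟩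
  | succ k ih =>
    obtain ⟨q, hq1, hq2⟩ := ih
    have hmono : scale k ^ 8 ≤ scale (k + 1) ^ 8 := monotone_scale_pow (Nat.le_succ k)
    by_cases h : (goodSet D (scale k) e).Nonempty ∧
        0 < (-1) ^ altCount D k e * rmfSum e (sInf (goodSet D (scale k) e))
    swap
    · simp only [altCount, if_neg h, add_zero]
      exact ⟨q, fun i hi => ⟨(hq1 i hi).1, (hq1 i hi).2.1.trans hmono, (hq1 i hi).2.2⟩, hq2⟩
    simp only [altCount, if_pos h]
    set c := altCount D k e
    set y := sInf (goodSet D (scale k) e)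
    have hy := Finset.mem_Ioc.mp (Nat.sInf_mem h.1).1
    refine ⟨Function.update q c y, fun i hi => ?_, fun i j hij hj => ?_⟩
    · rcases Nat.lt_succ_iff_lt_or_eq.mp hi with hi' | rfl
      · rw [Function.update_of_ne hi'.ne]
        exact ⟨(hq1 i hi').1, (hq1 i hi').2.1.trans hmono, (hq1 i hi').2.2⟩
      · rw [Function.update_self]
        refine ⟨by omega, hy.2.trans ?_, h.2⟩
        rw [scale_succ_pow]
        exact Nat.pow_le_pow_right (by linarith [two_le_scale k]) (by norm_num)
    · have hi : i < c := by omega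
      rw [Function.update_of_ne hi.ne]
      rcases Nat.lt_succ_iff_lt_or_eq.mp hj with hj' | rfl
      · rw [Function.update_of_ne hj'.ne]
        exact hq2 i j hij hj'
      · rw [Function.update_self]
        exact (hq1 i hi).2.1.trans_lt hy.1

/-- The signs are exactly the powers of -1, so neither deleting zeros nor `destutter` removes a
term. -/
theorem le_signChangesOn {g : ℝ → ℝ} {I : Set ℝ} {n : ℕ} {q : ℕ → ℝ} (hI : ∀ i < n, q i ∈ I)
    (hmono : ∀ i j, i < j → j < n → q i < q j) (halt : ∀ i < n, 0 < (-1) ^ i * g (q i)) :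
    ((n - 1 : ℕ) : ℕ∞) ≤ signChangesOn g I := by
  set l := (List.range n).map q with hl
  have hpw : l.Pairwise (· < ·) := by
    rw [hl, List.pairwise_map]
    refine List.pairwise_lt_range.imp_of_mem fun {i j} _ hj hij => ?_
    exact hmono i j hij (List.mem_range.mp hj)
  have hmem : ∀ a ∈ l, a ∈ I := by
    intro a ha
    obtain ⟨i, hi, rfl⟩ := List.mem_map.mp ha
    exact hI i (List.mem_range.mp hi)
  have hsign : (l.map g).map SignType.sign = (List.range n).map fun i => (-1 : SignType) ^ i := by
    rw [hl, List.map_map, List.map_map]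
    refine List.map_congr_left fun i hi => ?_
    have h := halt i (List.mem_range.mp hi)
    simp only [Function.comp_apply]
    rcases Nat.even_or_odd i with h2 | h2
    · rw [h2.neg_one_pow] at h ⊢
      exact sign_pos (by linarith)
    · rw [h2.neg_one_pow] at h ⊢
      exact sign_neg (by linarith)
  have hpow : ∀ i : ℕ, (-1 : SignType) ^ i ≠ 0 := fun i => pow_ne_zero i (by decide)
  have hcount : seqSignChanges (l.map g) = n - 1 := by
    rw [seqSignChanges, hsign, List.filter_eq_self.mpr, List.destutter_of_isChain,
      List.length_map, List.length_range]
    · rw [List.isChain_map, List.isChain_range]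
      intro i _
      rw [pow_succ]
      have := hpow i
      revert this
      generalize (-1 : SignType) ^ i = x
      revert x
      decide
    · intro a ha
      obtain ⟨i, _, rfl⟩ := List.mem_map.mp ha
      simp
  rw [← hcount]
  exact le_iSup₂_of_le (f := fun (l : List ℝ) (_ : l.Pairwise (· < ·) ∧ ∀ a ∈ l, a ∈ I) =>
    (seqSignChanges (l.map g) : ℕ∞)) l ⟨hpw, hmem⟩ le_rfl

/-! ### Counting growth steps, failures and good steps -/

/-- A sequence of subexponential growth has few steps of large growth. -/
theorem pow_card_growth_le {E : ℕ → ℝ} (hE : ∀ j, 1 ≤ E j) (hmono : Monotone E) {G : ℝ}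
    (hG : 0 ≤ G) {p : ℕ → Prop} [DecidablePred p] (hp : ∀ j, p j → G * E j ≤ E (j + 4)) (K : ℕ) :
    G ^ ((Finset.range K).filter p).card ≤ E K * E (K + 1) * E (K + 2) * E (K + 3) := by
  have h0 : ∀ j, 0 ≤ E j := fun j => zero_le_one.trans (hE j)
  induction K with
  | zero =>
    have h1 := one_le_mul_of_one_le_of_one_le (one_le_mul_of_one_le_of_one_le
      (one_le_mul_of_one_le_of_one_le (hE 0) (hE 1)) (hE 2)) (hE 3)
    simpa using h1
  | succ K ih =>
    -- In the product of four consecutive terms, the passage from K to K + 1 replaces E K by E (K +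
    -- 4), which gains G at a growth step.
    set F := E (K + 1) * E (K + 2) * E (K + 3) with hF
    have hF0 : 0 ≤ F := mul_nonneg (mul_nonneg (h0 _) (h0 _)) (h0 _)
    have e1 : E K * E (K + 1) * E (K + 2) * E (K + 3) = E K * F := by rw [hF]; ring
    have e2 : E (K + 1) * E (K + 1 + 1) * E (K + 1 + 2) * E (K + 1 + 3) = E (K + 4) * F := by
      rw [hF]; ring
    rw [e1] at ih
    rw [e2, Finset.range_add_one, Finset.filter_insert]
    split_ifs with h
    · rw [Finset.card_insert_of_notMem (by simp), pow_succ]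
      calc _ ≤ E K * F * G := by gcongr
        _ = G * E K * F := by ring
        _ ≤ _ := by gcongr; exact hp K h
    · refine ih.trans ?_
      gcongr
      exact hmono (by omega)

theorem prod_ite_one_eq_pow {α : Type*} [CommMonoid α] (a : α) (s : Finset ℕ) (p : ℕ → Prop)
    [DecidablePred p] : ∏ j ∈ s, (if p j then a else 1) = a ^ (s.filter p).card := by
  simp [Finset.prod_ite]

open Classical in
theorem altCount_eq_card (D : ℝ) (e : ℕ → Bool) (K : ℕ) :
    altCount D K e = ((Finset.range K).filter fun k => (goodSet D (scale k) e).Nonempty ∧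
        0 < (-1) ^ altCount D k e * rmfSum e (sInf (goodSet D (scale k) e))).card := by
  induction K with
  | zero => rfl
  | succ K ih =>
    rw [Finset.range_add_one, Finset.filter_insert, altCount]
    split_ifs with h
    · rw [Finset.card_insert_of_notMem (by simp), ← ih]
    · rw [← ih, add_zero]

/-- The energy multiplies by a large factor at scale `j`. -/
def IsGrowth (D : ℝ) (j : ℕ) (e : ℕ → Bool) : Prop :=
  D ^ 2 / 2560 * energy e (scale j) ≤ energy e (scale j ^ 16)

theorem dependsOn_isGrowth (D : ℝ) (j : ℕ) :
    DependsOn (IsGrowth D j) (primesUpTo (scale (j + 1) ^ 8)) := by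
  intro e e' h
  have hle : scale j ≤ scale j ^ 16 := Nat.le_self_pow (by norm_num) _
  have h1 : energy e (scale j) = energy e' (scale j) :=
    dependsOn_energy (by rw [scale_succ_pow]; omega) h
  have h2 : energy e (scale j ^ 16) = energy e' (scale j ^ 16) :=
    dependsOn_energy (by rw [scale_succ_pow]; omega) h
  simp only [IsGrowth, h1, h2]

namespace IsFairBits

variable {Ω : Type*} [MeasurableSpace Ω] {P : Measure Ω} [IsProbabilityMeasure P]
  {b : Ω → ℕ → Bool}

open Classical in
-- A growth step gains at least 2^36 from index j to j + 4, while the energy at index k is at most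
-- 4^k. So 36c ≤ 8(K + 3), which gives 4c ≤ K once K ≥ 24.
theorem ae_eventually_card_growth_le (hb : IsFairBits P b) {D : ℝ} (hD : 2 ^ 36 ≤ D ^ 2 / 2560) :
    ∀ᵐ ω ∂P, ∀ᶠ K : ℕ in atTop,
      4 * ((Finset.range K).filter fun j => IsGrowth D j (b ω)).card ≤ K := by
  filter_upwards [hb.ae_eventually_energy_le] with ω hω
  filter_upwards [(tendsto_add_atTop_nat 3).eventually hω, eventually_ge_atTop 24] with K hK hK24
  set E : ℕ → ℝ := fun j => energy (b ω) (scale j) with hE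
  have hE1 : ∀ j, 1 ≤ E j := fun j => one_le_energy _ (two_le_scale j)
  have hmono : Monotone E := fun i j h => energy_mono _
    (Nat.pow_le_pow_right two_pos (Nat.pow_le_pow_right two_pos h))
  have h1 := pow_card_growth_le hE1 hmono (G := 2 ^ 36) (by positivity)
    (p := fun j => IsGrowth D j (b ω)) (fun j hj => by
      change _ * energy (b ω) (scale j) ≤ energy (b ω) (scale (j + 4))
      rw [scale_add]
      refine le_trans ?_ hj
      gcongr
      exact zero_le_one.trans (hE1 j)) K
  set c := ((Finset.range K).filter fun j => IsGrowth D j (b ω)).card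
  have h0 : ∀ j, 0 ≤ E j := fun j => zero_le_one.trans (hE1 j)
  have hle : ∀ i ≤ 3, E (K + i) ≤ 4 ^ (K + 3) := fun i hi =>
    (hmono (by omega : K + i ≤ K + 3)).trans hK
  have h2 : ((2 : ℝ) ^ 36) ^ c ≤ 4 ^ (K + 3) * 4 ^ (K + 3) * 4 ^ (K + 3) * 4 ^ (K + 3) := by
    refine h1.trans ?_
    have a0 := hle 0 (by norm_num)
    have a1 := hle 1 (by norm_num)
    have a2 := hle 2 (by norm_num)
    have a3 := hle 3 le_rfl
    rw [add_zero] at a0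
    have := h0 K
    have := h0 (K + 1)
    have := h0 (K + 2)
    have := h0 (K + 3)
    gcongr
  have h3 : (2 : ℝ) ^ (36 * c) ≤ 2 ^ (8 * (K + 3)) := by
    calc (2 : ℝ) ^ (36 * c) = (2 ^ 36) ^ c := pow_mul _ _ _
      _ ≤ _ := h2
      _ = 2 ^ (8 * (K + 3)) := by
        rw [← pow_add, ← pow_add, ← pow_add, show (4 : ℝ) = 2 ^ 2 by norm_num, ← pow_mul]
        congr 1
        ring
  have h4 := (pow_le_pow_iff_right₀ (by norm_num : (1 : ℝ) < 2)).mp h3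
  omega

open Classical in
-- At a step without good points, weight 128 for a failure (probability at most 1/256) and 1/2
-- otherwise has mean at most 1. The product bound with ρ = 2 yields 256^c ≤ 4^K.
theorem ae_eventually_card_failure_le (hb : IsFairBits P b) {D : ℝ} (hD : 0 < D)
    (hD2 : 8 / D ^ 2 ≤ 1 / 256) {j₀ : ℕ}
    (hj₀ : ∀ j ≥ j₀, 640 * (4 * D + 4) ^ 2 ≤ (scale j : ℝ) ^ 2 ∧
      (1 : ℝ) / 80 ≤ ∑ p ∈ primesIoc (scale j ^ 9) (scale j ^ 10), (1 : ℝ) / p) :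
    ∀ᵐ ω ∂P, ∀ᶠ K : ℕ in atTop,
      4 * ((Finset.range K).filter fun j =>
        (j₀ ≤ j ∧ goodSet D (scale j) (b ω) = ∅) ∧ ¬ IsGrowth D j (b ω)).card ≤ K := by
  set X : ℕ → (ℕ → Bool) → ℝ≥0∞ := fun j e =>
    if j₀ ≤ j ∧ goodSet D (scale j) e = ∅ then
      (if ¬ IsGrowth D j e then ENNReal.ofReal 128 else ENNReal.ofReal (1 / 2)) else 1 with hX
  have hXdep : ∀ j, DependsOn (X j) (primesUpTo (scale (j + 1) ^ 8)) := by
    intro j e e' h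
    have h1 : goodSet D (scale j) e = goodSet D (scale j) e' :=
      (dependsOn_goodSet D (scale j)).mono
        (primesUpTo_mono (monotone_scale_pow (Nat.le_succ j))) h
    have h2 : IsGrowth D j e = IsGrowth D j e' := dependsOn_isGrowth D j h
    refine if_congr (by rw [h1]) (if_congr (by rw [h2]) rfl rfl) rfl
  have hmean : ∀ j u, ∫⁻ ω, X j (mix (scale j ^ 8) u (b ω)) ∂P ≤ 1 := by
    intro j u
    have h1 : ∀ ω, goodSet D (scale j) (mix (scale j ^ 8) u (b ω)) = goodSet D (scale j) u :=
      fun ω => (dependsOn_goodSet D (scale j)).mix_eq u (b ω)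
    simp only [hX, h1]
    by_cases h : j₀ ≤ j ∧ goodSet D (scale j) u = ∅
    swap
    · simp [h]
    simp only [if_pos h]
    have hm : MeasurableSet {ω | ¬ IsGrowth D j (mix (scale j ^ 8) u (b ω))} :=
      hb.measurableSet_setOf (A := fun e => ¬ IsGrowth D j (mix (scale j ^ 8) u e))
        (N := scale (j + 1) ^ 8) fun e e' h => by
          have := (dependsOn_isGrowth D j).mix_right (scale j ^ 8) u h
          simp only [this]
    rw [lintegral_ite_ofReal hm (by norm_num) (by norm_num)]
    refine ENNReal.ofReal_le_one.mpr ?_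
    have h2 := hb.measureReal_not_growth_le hD (two_le_scale j) (hj₀ j h.1).1 (hj₀ j h.1).2 h.2
    have h3 : ∀ ω, energy (mix (scale j ^ 8) u (b ω)) (scale j) = energy u (scale j) := fun ω =>
      (dependsOn_energy (N := scale j ^ 8) (M := scale j)
        ((Nat.le_self_pow (by norm_num) _).trans (Nat.le_succ _))).mix_eq u (b ω)
    have h4 : P.real {ω | ¬ IsGrowth D j (mix (scale j ^ 8) u (b ω))} ≤ 1 / 256 := by
      simp only [IsGrowth, h3]
      exact h2.trans hD2
    linarith
  have h2 : (1 : ℝ≥0∞) < 2 := by norm_num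
  filter_upwards [hb.ae_eventually_prod_le monotone_scale_pow hXdep hmean h2 (by simp)] with ω hω
  filter_upwards [hω] with K hK
  set p : ℕ → Prop := fun j =>
        (j₀ ≤ j ∧ goodSet D (scale j) (b ω) = ∅) ∧ ¬ IsGrowth D j (b ω) with hp
  have hXle : ∀ j ∈ Finset.range K,
      ENNReal.ofReal (1 / 2) * (if p j then ENNReal.ofReal 256 else 1) ≤ X j (b ω) := by
    intro j _
    have hhalf : ENNReal.ofReal (1 / 2) ≤ 1 := ENNReal.ofReal_le_one.mpr (by norm_num)
    simp only [hX, hp]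
    by_cases h1 : j₀ ≤ j ∧ goodSet D (scale j) (b ω) = ∅
    · by_cases h2 : ¬ IsGrowth D j (b ω)
      · rw [if_pos ⟨h1, h2⟩, if_pos h1, if_pos h2, ← ENNReal.ofReal_mul (by norm_num)]
        norm_num
      · rw [if_neg fun h => h2 h.2, if_pos h1, if_neg h2, mul_one]
    · rw [if_neg fun h => h1 h.1, if_neg h1, mul_one]
      exact hhalf
  have h3 := (Finset.prod_le_prod' hXle).trans hK
  rw [Finset.prod_mul_distrib, prod_ite_one_eq_pow, Finset.prod_const, Finset.card_range,
    ← ENNReal.ofReal_ofNat 2, ← ENNReal.ofReal_pow (by norm_num),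
    ← ENNReal.ofReal_pow (by norm_num), ← ENNReal.ofReal_pow (by norm_num),
    ← ENNReal.ofReal_mul (by positivity), ENNReal.ofReal_le_ofReal_iff (by positivity)] at h3
  set c := ((Finset.range K).filter p).card
  have h4 : (2 : ℝ) ^ (8 * c) ≤ 2 ^ (2 * K) := by
    have e1 : (2 : ℝ) ^ (8 * c) = 256 ^ c := by rw [pow_mul]; norm_num
    have e2 : (2 : ℝ) ^ (2 * K) = 2 ^ K * 2 ^ K := by rw [two_mul, pow_add]
    have e3 : (2 : ℝ) ^ K * (1 / 2) ^ K = 1 := by rw [← mul_pow]; norm_num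
    rw [e1, e2]
    calc (256 : ℝ) ^ c = 2 ^ K * ((1 / 2) ^ K * 256 ^ c) := by rw [← mul_assoc, e3, one_mul]
      _ ≤ _ := by gcongr
  have h5 := (pow_le_pow_iff_right₀ (by norm_num : (1 : ℝ) < 2)).mp h4
  omega

open Classical in
-- At a good step, halving the weight when the wanted sign appears lowers its mean by a fixed
-- proportion, which pays for the factor ρ^8. The first good point is frozen; only its sign is
-- fresh.
theorem ae_eventually_pow_card_good_le (hb : IsFairBits P b) {D : ℝ} (hD : 0 ≤ D) {ρ : ℝ}
    (hρ : 1 < ρ) (hρD : ρ ^ 8 * (1 - Real.exp (-(3 / 2) * (4 * D + 4) ^ 2) / 4 / 2) ≤ 1) :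
    ∀ᵐ ω ∂P, ∀ᶠ K : ℕ in atTop,
      (ρ ^ 8) ^ ((Finset.range K).filter fun j => (goodSet D (scale j) (b ω)).Nonempty).card *
        (1 / 2) ^ altCount D K (b ω) ≤ ρ ^ K := by
  have hρ0 : 0 < ρ := by linarith
  set S : ℕ → (ℕ → Bool) → Prop := fun k e =>
    0 < (-1) ^ altCount D k e * rmfSum e (sInf (goodSet D (scale k) e)) with hS
  set X : ℕ → (ℕ → Bool) → ℝ≥0∞ := fun j e =>
    if (goodSet D (scale j) e).Nonempty then
      (if S j e then ENNReal.ofReal (ρ ^ 8 / 2) else ENNReal.ofReal (ρ ^ 8)) else 1 with hX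
  have hSdep : ∀ j e e', (goodSet D (scale j) e).Nonempty →
      (∀ p ∈ primesUpTo (scale (j + 1) ^ 8), e p = e' p) → (S j e ↔ S j e') := by
    intro j e e' hne h
    have hm := primesUpTo_mono (monotone_scale_pow (Nat.le_succ j))
    have h1 : goodSet D (scale j) e = goodSet D (scale j) e' :=
      (dependsOn_goodSet D (scale j)).mono hm h
    have h2 : altCount D j e = altCount D j e' := (dependsOn_altCount D j).mono hm h
    have h3 : rmfSum e (sInf (goodSet D (scale j) e)) =
        rmfSum e' (sInf (goodSet D (scale j) e)) := by
      refine dependsOn_rmfSum ?_ h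
      refine (Finset.mem_Ioc.mp (Nat.sInf_mem hne).1).2.trans ?_
      rw [scale_succ_pow]
      exact Nat.pow_le_pow_right (by linarith [two_le_scale j]) (by norm_num)
    simp only [hS, h2, h3, ← h1]
  have hXdep : ∀ j, DependsOn (X j) (primesUpTo (scale (j + 1) ^ 8)) := by
    intro j e e' h
    have h1 : goodSet D (scale j) e = goodSet D (scale j) e' :=
      (dependsOn_goodSet D (scale j)).mono
        (primesUpTo_mono (monotone_scale_pow (Nat.le_succ j))) h
    by_cases hne : (goodSet D (scale j) e).Nonempty
    · simp only [hX, if_pos hne, if_pos (h1 ▸ hne)]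
      exact if_congr (hSdep j e e' hne h) rfl rfl
    · simp only [hX, if_neg hne, if_neg (h1 ▸ hne)]
  have hmean : ∀ j u, ∫⁻ ω, X j (mix (scale j ^ 8) u (b ω)) ∂P ≤ 1 := by
    intro j u
    have h1 : ∀ ω, goodSet D (scale j) (mix (scale j ^ 8) u (b ω)) = goodSet D (scale j) u :=
      fun ω => (dependsOn_goodSet D (scale j)).mix_eq u (b ω)
    have h2 : ∀ ω, altCount D j (mix (scale j ^ 8) u (b ω)) = altCount D j u :=
      fun ω => (dependsOn_altCount D j).mix_eq u (b ω)
    by_cases h : (goodSet D (scale j) u).Nonempty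
    swap
    · simp [hX, h1, h]
    have hm : MeasurableSet {ω | S j (mix (scale j ^ 8) u (b ω))} :=
      hb.measurableSet_setOf (A := fun e => S j (mix (scale j ^ 8) u e))
        (N := scale (j + 1) ^ 8) fun e e' hee => by
          refine propext (hSdep j _ _ ?_ fun p hp => ?_)
          · rw [(dependsOn_goodSet D (scale j)).mix_eq u e]
            exact h
          · simp only [mix, hee p hp]
    simp only [hX, h1, if_pos h]
    rw [lintegral_ite_ofReal hm (by positivity) (by positivity)]
    refine ENNReal.ofReal_le_one.mpr ?_
    have h3 := hb.le_measureReal_sign hD (Nat.sInf_mem h) (σ := (-1) ^ altCount D j u)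
      (by rw [← pow_mul, mul_comm, pow_mul]; simp)
    have h4 : P.real {ω | S j (mix (scale j ^ 8) u (b ω))} = P.real {ω | 0 <
        (-1) ^ altCount D j u * rmfSum (mix (scale j ^ 8) u (b ω))
          (sInf (goodSet D (scale j) u))} := by
      simp only [hS, h1, h2]
    rw [← h4] at h3
    have h5 : 0 < ρ ^ 8 := by positivity
    nlinarith
  have hρ1 : (1 : ℝ≥0∞) < ENNReal.ofReal ρ := ENNReal.one_lt_ofReal.mpr hρ
  filter_upwards [hb.ae_eventually_prod_le monotone_scale_pow hXdep hmean hρ1 (by simp)]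
    with ω hω
  filter_upwards [hω] with K hK
  have hXeq : ∀ j ∈ Finset.range K, X j (b ω) =
      (if (goodSet D (scale j) (b ω)).Nonempty then ENNReal.ofReal (ρ ^ 8) else 1) *
      (if (goodSet D (scale j) (b ω)).Nonempty ∧ S j (b ω) then ENNReal.ofReal (1 / 2) else 1) := by
    intro j _
    by_cases h1 : (goodSet D (scale j) (b ω)).Nonempty
    · by_cases h2 : S j (b ω)
      · simp only [hX, if_pos h1, if_pos h2, if_pos (And.intro h1 h2)]
        rw [← ENNReal.ofReal_mul (by positivity), mul_one_div]
      · simp only [hX, if_pos h1, if_neg h2, if_neg fun h : _ ∧ _ => h2 h.2, mul_one]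
    · simp only [hX, if_neg h1, if_neg fun h : _ ∧ _ => h1 h.1, mul_one]
  rw [Finset.prod_congr rfl hXeq, Finset.prod_mul_distrib, prod_ite_one_eq_pow,
    prod_ite_one_eq_pow, ← altCount_eq_card D (b ω) K,
    ← ENNReal.ofReal_pow (by positivity), ← ENNReal.ofReal_pow (by norm_num),
    ← ENNReal.ofReal_pow (by positivity),
    ← ENNReal.ofReal_mul (by positivity), ENNReal.ofReal_le_ofReal_iff (by positivity)] at hK
  exact hK

end IsFairBits

/-! ### Linear growth of alternations and conclusion -/

theorem exists_one_lt_pow_mul_le {t : ℝ} (h0 : 0 < t) (h1 : t < 1) :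
    ∃ ρ : ℝ, 1 < ρ ∧ ρ ^ 8 * (1 - t) ≤ 1 := by
  have hpos : 0 < 1 - t := by linarith
  refine ⟨(1 / (1 - t)) ^ (1 / 8 : ℝ), ?_, ?_⟩
  · refine Real.one_lt_rpow ?_ (by norm_num)
    rw [lt_div_iff₀ hpos]
    linarith
  · rw [← Real.rpow_natCast, ← Real.rpow_mul (by positivity)]
    norm_num
    rw [inv_mul_cancel₀ hpos.ne']

theorem le_scale (j : ℕ) : j ≤ scale j :=
  (Nat.lt_two_pow_self.trans Nat.lt_two_pow_self).le

/-- Almost surely, the number of alternations grows at least linearly. -/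
theorem exists_le_altCount : ∃ D κ : ℝ, 0 < κ ∧
    ∀ (Ω : Type*) [MeasurableSpace Ω] (P : Measure Ω) [IsProbabilityMeasure P]
      (b : Ω → ℕ → Bool), IsFairBits P b →
      ∀ᵐ ω ∂P, ∀ᶠ K : ℕ in atTop, κ * K ≤ altCount D K (b ω) := by
  classical
  -- As 2560 ≤ 2^12, this gives D²/2560 ≥ 2^36, and amply 8/D² ≤ 1/256. Keeping D opaque prevents
  -- the numeral from being unfolded.
  obtain ⟨D, hD⟩ : ∃ D : ℝ, D = 2 ^ 24 := ⟨_, rfl⟩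
  have hD0 : 0 < D := by rw [hD]; positivity
  have hlt : Real.exp (-(3 / 2) * (4 * D + 4) ^ 2) ≤ 1 := Real.exp_le_one_iff.mpr (by
    have := sq_nonneg (4 * D + 4)
    linarith)
  obtain ⟨ρ, hρ, hρD⟩ := exists_one_lt_pow_mul_le
    (t := Real.exp (-(3 / 2) * (4 * D + 4) ^ 2) / 4 / 2) (by positivity) (by linarith)
  have hl2 : 0 < Real.log 2 := Real.log_pos one_lt_two
  refine ⟨D, Real.log ρ / Real.log 2, div_pos (Real.log_pos hρ) hl2, ?_⟩
  intro Ω _ P _ b hb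
  have hscale : ∀ᶠ j : ℕ in atTop, 640 * (4 * D + 4) ^ 2 ≤ (scale j : ℝ) ^ 2 := by
    filter_upwards [tendsto_natCast_atTop_atTop.eventually_ge_atTop (640 * (4 * D + 4) ^ 2)]
      with j hj
    have h1 : (j : ℝ) ≤ scale j := by exact_mod_cast le_scale j
    have h2 : (2 : ℝ) ≤ scale j := by exact_mod_cast two_le_scale j
    nlinarith
  obtain ⟨j₀, hj₀⟩ := eventually_atTop.mp (hscale.and eventually_sum_inv_primesIoc_pow)
  filter_upwards [hb.ae_eventually_card_growth_le (D := D) (by rw [hD]; norm_num),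
    hb.ae_eventually_card_failure_le hD0 (by rw [hD]; norm_num) hj₀,
    hb.ae_eventually_pow_card_good_le hD0.le hρ hρD] with ω h1 h2 h3
  filter_upwards [h1, h2, h3, eventually_ge_atTop (4 * j₀)] with K h1 h2 h3 hK
  set g := ((Finset.range K).filter fun j => (goodSet D (scale j) (b ω)).Nonempty).card
  set c := altCount D K (b ω)
  -- Initial steps, growth steps and failures each number at most K/4, so at least K/4 steps are
  -- good. Then ρ^(8g) ≥ ρ^(2K), which leaves ρ^K ≤ 2^c.
  have hcover : Finset.range K ⊆ Finset.range j₀ ∪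
      ((Finset.range K).filter fun j => (goodSet D (scale j) (b ω)).Nonempty) ∪
      ((Finset.range K).filter fun j => IsGrowth D j (b ω)) ∪
      ((Finset.range K).filter fun j =>
        (j₀ ≤ j ∧ goodSet D (scale j) (b ω) = ∅) ∧ ¬ IsGrowth D j (b ω)) := by
    intro j hj
    simp only [Finset.mem_union, Finset.mem_filter, hj, true_and, Finset.mem_range,
      ← Set.not_nonempty_iff_eq_empty]
    by_cases hj0 : j < j₀
    · exact Or.inl (Or.inl (Or.inl hj0))
    · have := not_lt.mp hj0
      tauto
  have hcard := Finset.card_le_card hcover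
  have hu1 := Finset.card_union_le (Finset.range j₀ ∪
      ((Finset.range K).filter fun j => (goodSet D (scale j) (b ω)).Nonempty) ∪
      ((Finset.range K).filter fun j => IsGrowth D j (b ω)))
      ((Finset.range K).filter fun j =>
        (j₀ ≤ j ∧ goodSet D (scale j) (b ω) = ∅) ∧ ¬ IsGrowth D j (b ω))
  have hu2 := Finset.card_union_le (Finset.range j₀ ∪
      ((Finset.range K).filter fun j => (goodSet D (scale j) (b ω)).Nonempty))
      ((Finset.range K).filter fun j => IsGrowth D j (b ω))
  have hu3 := Finset.card_union_le (Finset.range j₀)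
      ((Finset.range K).filter fun j => (goodSet D (scale j) (b ω)).Nonempty)
  simp only [Finset.card_range] at hcard hu3
  have hg : K ≤ 4 * g := by omega
  have hρ0 : 0 < ρ := by linarith
  have h4 : ρ ^ (2 * K) * (1 / 2) ^ c ≤ ρ ^ K := by
    refine le_trans ?_ h3
    rw [← pow_mul]
    exact mul_le_mul_of_nonneg_right (pow_le_pow_right₀ hρ.le (by omega)) (by positivity)
  have h5 : ρ ^ K ≤ 2 ^ c := by
    have e1 : (2 : ℝ) ^ c * (1 / 2) ^ c = 1 := by rw [← mul_pow]; norm_num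
    have h6 : ρ ^ K * ρ ^ K ≤ 2 ^ c * ρ ^ K := by
      calc ρ ^ K * ρ ^ K = 2 ^ c * (ρ ^ (2 * K) * (1 / 2) ^ c) := by
            rw [two_mul, pow_add, mul_left_comm, e1, mul_one]
        _ ≤ _ := by gcongr
    exact le_of_mul_le_mul_right h6 (by positivity)
  have h7 := Real.log_le_log (by positivity) h5
  rw [Real.log_pow, Real.log_pow] at h7
  rw [div_mul_eq_mul_div, div_le_iff₀ hl2]
  linarith

theorem mainTheorem7 :
    ∃ c : ℝ, 0 < c ∧
      ∀ (Ω : Type*) [MeasurableSpace Ω] (P : Measure Ω) [IsProbabilityMeasure P]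
        (f : ℕ → Ω → ℝ), IsRademacherRMF P f →
        ∀ᵐ ω ∂P, ∀ᶠ x : ℝ in atTop,
          ENNReal.ofReal (c * (iterLog 2 x / iterLog 4 x)) ≤
            ((signChangesOn (partialSum fun n => f n ω) (Set.Icc 1 x) : ℕ∞) : ℝ≥0∞) := by
  obtain ⟨D, κ, hκ, hmain⟩ := exists_le_altCount
  refine ⟨κ / 4, by positivity, ?_⟩
  intro Ω _ P _ f hf
  filter_upwards [hmain Ω P _ hf.isFairBits, hf.ae_eq_rmf] with ω hω hrmf
  set e : ℕ → Bool := fun p => decide (f p ω = 1)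
  have hL : Tendsto (fun x : ℝ => Real.log (Real.log x)) atTop atTop :=
    Real.tendsto_log_atTop.comp Real.tendsto_log_atTop
  have hK : Tendsto (fun x : ℝ => ⌊Real.log (Real.log x)⌋₊ - 3) atTop atTop :=
    (tendsto_sub_atTop_nat 3).comp (tendsto_nat_floor_atTop.comp hL)
  filter_upwards [hK.eventually hω, hL.eventually_ge_atTop 8, hL.eventually_ge_atTop (4 / κ),
    (Real.tendsto_log_atTop.comp (Real.tendsto_log_atTop.comp hL)).eventually_ge_atTop 1,
    Real.tendsto_log_atTop.eventually_gt_atTop 0, eventually_gt_atTop 0]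
    with x hcount hL8 hLκ hlog4 hlogx hx0
  set L := Real.log (Real.log x) with hLdef
  -- The shift by 3 absorbs the eighth power: `scale K ^ 8` is 2^(2^(K+3)), and K + 3 ≤ log log x.
  set K := ⌊L⌋₊ - 3 with hKdef
  have hfl : 3 ≤ ⌊L⌋₊ := Nat.le_floor (by push_cast; linarith)
  have hKL : (K : ℝ) + 3 = ⌊L⌋₊ := by
    have : K + 3 = ⌊L⌋₊ := by omega
    exact_mod_cast this
  have hK3 : (K : ℝ) + 3 ≤ L := hKL ▸ Nat.floor_le (by linarith)
  have hKlow : L / 2 ≤ K := by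
    have := Nat.lt_floor_add_one L
    linarith
  have hscale : ((scale K ^ 8 : ℕ) : ℝ) ≤ x := by
    have h1 : scale K ^ 8 = 2 ^ 2 ^ (K + 3) := by
      rw [scale, ← pow_mul, pow_add]
      norm_num
    rw [h1]
    push_cast
    rw [← Real.log_le_log_iff (by positivity) hx0, Real.log_pow]
    push_cast
    have h2 : (2 : ℝ) ^ (K + 3) ≤ Real.log x := by
      rw [← Real.log_le_log_iff (by positivity) hlogx, Real.log_pow]
      push_cast
      have := Real.log_two_lt_d9
      have h3 : (0 : ℝ) ≤ (K : ℝ) + 3 := by positivity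
      nlinarith
    have := Real.log_two_lt_d9
    have : (0 : ℝ) < 2 ^ (K + 3) := by positivity
    nlinarith
  obtain ⟨q, hq1, hq2⟩ := exists_alternating_points D e K
  have hsc := le_signChangesOn (g := partialSum fun n => f n ω) (I := Set.Icc 1 x)
    (n := altCount D K e) (q := fun i => (q i : ℝ))
    (fun i hi => ⟨by exact_mod_cast (hq1 i hi).1,
      le_trans (by exact_mod_cast (hq1 i hi).2.1) hscale⟩)
    (fun i j hij hj => by exact_mod_cast hq2 i j hij hj)
    (fun i hi => by
      rw [partialSum_eq_rmfSum hrmf]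
      exact (hq1 i hi).2.2)
  have hsc' : ((altCount D K e - 1 : ℕ) : ℝ≥0∞) ≤
      ((signChangesOn (partialSum fun n => f n ω) (Set.Icc 1 x) : ℕ∞) : ℝ≥0∞) := by
    exact_mod_cast ENat.toENNReal_le.mpr hsc
  refine le_trans ?_ hsc'
  rw [← ENNReal.ofReal_natCast]
  refine ENNReal.ofReal_le_ofReal ?_
  have hi2 : iterLog 2 x = L := rfl
  have hi4 : 1 ≤ iterLog 4 x := hlog4
  rw [hi2]
  -- The factor log_4 x ≥ 1 is simply discarded. From κK ≥ κL/2, half is kept and the rest, at least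
  -- 1 since κL ≥ 4, pays for having one sign change fewer than points.
  have h1 : L / iterLog 4 x ≤ L := div_le_self (by linarith) hi4
  have h2 : κ * (L / 2) ≤ altCount D K e := (by gcongr : κ * (L / 2) ≤ κ * K).trans hcount
  have h3 : 4 ≤ κ * L := by
    rw [div_le_iff₀ hκ] at hLκ
    linarith
  have h4 : (altCount D K e : ℝ) - 1 ≤ ((altCount D K e - 1 : ℕ) : ℝ) := by
    rw [sub_le_iff_le_add]
    exact_mod_cast (by omega : altCount D K e ≤ altCount D K e - 1 + 1)
  calc κ / 4 * (L / iterLog 4 x) ≤ κ / 4 * L := by gcongr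
    _ ≤ _ := by linarith
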